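/- Let $X_1,X_2,\dots$ be independent random variables with $\mathbb{P}(X_k=1)=\mathbb{P}(X_k=-1)=\tfrac12$ for every $k\ge 1$. Let $c>0$, put $a_k=c\ln k$ for $k\ge 1$ (equivalently, $a_k=\log_\gamma k$ with $\gamma=e^{1/c}>1$), and let $S(n)=\sum_{k=1}^n a_kX_k$, $S(0)=0$, be the corresponding walk. Then almost surely the walk is $C$-recurrent for every $C>0$; that is, with probability one, for every real $C>0$ the inequality $|S(n)|\le C$ holds for infinitely many $n$. -/

import Mathlib

open MeasureTheory ProbabilityTheory Filter

namespace AWalk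

variable {Ω : Type*} [MeasurableSpace Ω]

/-- `Y` is a random variable with `P(Y = 1) = P(Y = -1) = 1/2`. -/
structure IsRademacher (Y : Ω → ℝ) (μ : Measure Ω) : Prop where
  measurable : Measurable Y
  prob_one : μ {ω | Y ω = 1} = 1 / 2
  prob_neg_one : μ {ω | Y ω = -1} = 1 / 2

/-- `X 1, X 2, …` are i.i.d. Rademacher variables. The value `X 0` plays no role. -/
structure IsRademacherSequence (X : ℕ → Ω → ℝ) (μ : Measure Ω) : Prop where
  rademacher : ∀ k : ℕ, 1 ≤ k → IsRademacher (X k) μ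
  indep : iIndepFun (fun k : ℕ => X (k + 1)) μ

/-- The `a`-walk `S(n) = a₁ X₁ + ⋯ + aₙ Xₙ`, with `S(0) = 0`. -/
def walk {Ω : Type*} (a : ℕ → ℝ) (X : ℕ → Ω → ℝ) (n : ℕ) (ω : Ω) : ℝ :=
  ∑ k ∈ Finset.Icc 1 n, a k * X k ω

/-- The path `s` is `C`-recurrent: `|s n| ≤ C` for infinitely many `n`. -/
def IsCRecurrent (C : ℝ) (s : ℕ → ℝ) : Prop :=
  {n : ℕ | |s n| ≤ C}.Infinite

end AWalk

/-!
Dividing by `c`, we may take the steps to be `± log k`. Fix a smooth bump supported in `[-C, C]` and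
let `N = u ^ 4` be large. By Fourier inversion, the expected value of the bump at the walk after the
steps `m, …, n - 1` is an integral against `∏ cos (t log k)`.

* Frequencies `|t| ≤ 1 / log N` contribute on the scale of a Gaussian density with variance
  `(n - m) log² N`.
* Frequencies `|t| > 1 / log N` contribute `O (1 / N)` as soon as `n - m ≥ N ^ (3 / 4)`: the phases
  `t log k` and `t log (k + h)` differ by about `t h / N`, so that for a suitable shift `h` they
  cannot both be close to `π ℤ`, which makes the product of cosines small. For `|t| > N / 4` the
  decay of the Fourier transform of the bump suffices.

Hence, from any bounded position, the bump collects an expected amount of at least a constant times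
`√N / log N` over the times in `[2 N, 4 N)`. It collects at most a constant times `√N / log N` from
any position at any time in this window: the Fourier bound covers times that are at least
`N ^ (3 / 4)` steps ahead, and the Littlewood–Offord bound `O (1 / √j)` covers the first
`N ^ (3 / 4)` steps `j`, whose total is negligible. Decomposing at the first visit to `[-C, C]`, the
walk visits `[-C, C]` during the window with conditional probability at least some `δ > 0` that
depends neither on the past nor on `N`, and therefore visits it infinitely often.
-/

namespace AWalk

open scoped ENNReal Topology FourierTransform SchwartzMap

section Independence

variable {Ω α β : Type*} {m mΩ : MeasurableSpace Ω} [MeasurableSpace α] [MeasurableSpace β]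
  {μ : Measure Ω} [IsFiniteMeasure μ]

theorem map_prodMk_restrict_eq_prod_of_indep (hm : m ≤ mΩ)
    {U : Ω → α} {V : Ω → β} (hU : Measurable[m] U) (hV : Measurable V)
    (hind : Indep m (MeasurableSpace.comap V inferInstance) μ)
    {B : Set Ω} (hB : MeasurableSet[m] B) :
    (μ.restrict B).map (fun ω => (U ω, V ω)) = ((μ.restrict B).map U).prod (μ.map V) := by
  have hU' : Measurable U := hU.mono hm le_rfl
  refine (Measure.prod_eq fun s t hs ht => ?_).symm
  have hUs : MeasurableSet[m] (U ⁻¹' s ∩ B) := (hU hs).inter hB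
  have hset : (fun ω => (U ω, V ω)) ⁻¹' s ×ˢ t ∩ B = (U ⁻¹' s ∩ B) ∩ V ⁻¹' t := by
    ext ω
    simp only [Set.mem_inter_iff, Set.mem_preimage, Set.mem_prod]
    tauto
  rw [Measure.map_apply (hU'.prodMk hV) (hs.prod ht),
    Measure.restrict_apply ((hU'.prodMk hV) (hs.prod ht)), hset,
    (Indep_iff _ _ μ).1 hind _ _ hUs ⟨t, ht, rfl⟩, Measure.map_apply hU' hs,
    Measure.restrict_apply (hU' hs), Measure.map_apply hV ht]

theorem setLIntegral_prodMk_eq_of_indep (hm : m ≤ mΩ)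
    {U : Ω → α} {V : Ω → β} (hU : Measurable[m] U) (hV : Measurable V)
    (hind : Indep m (MeasurableSpace.comap V inferInstance) μ)
    {B : Set Ω} (hB : MeasurableSet[m] B) {f : α × β → ℝ≥0∞} (hf : Measurable f) :
    ∫⁻ ω in B, f (U ω, V ω) ∂μ = ∫⁻ ω in B, ∫⁻ ω', f (U ω, V ω') ∂μ ∂μ := by
  have hU' : Measurable U := hU.mono hm le_rfl
  calc ∫⁻ ω in B, f (U ω, V ω) ∂μ
      = ∫⁻ z, f z ∂((μ.restrict B).map fun ω => (U ω, V ω)) :=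
        (lintegral_map hf (hU'.prodMk hV)).symm
    _ = ∫⁻ x, ∫⁻ y, f (x, y) ∂(μ.map V) ∂((μ.restrict B).map U) := by
        rw [map_prodMk_restrict_eq_prod_of_indep hm hU hV hind hB, lintegral_prod _ hf.aemeasurable]
    _ = ∫⁻ ω in B, ∫⁻ ω', f (U ω, V ω') ∂μ ∂μ := by
        rw [lintegral_map hf.lintegral_prod_right' hU']
        exact lintegral_congr fun ω => lintegral_map (hf.comp measurable_prodMk_left) hV

end Independence

/-- The increment `ξ m + ⋯ + ξ (n - 1)` between the times `m` and `n` of the random walk with steps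
`ξ 0, ξ 1, …`, which is at `increment ξ 0 n` at time `n`. -/
def increment {Ω : Type*} (ξ : ℕ → Ω → ℝ) (m n : ℕ) (ω : Ω) : ℝ :=
  ∑ k ∈ Finset.Ico m n, ξ k ω

/-- The σ-algebra generated by the steps `ξ k` with `k ∈ T`. The past at time `n` of the walk is the
case `T = Set.Iio n`. -/
abbrev stepAlgebra {Ω : Type*} (ξ : ℕ → Ω → ℝ) (T : Set ℕ) : MeasurableSpace Ω :=
  ⨆ k ∈ T, MeasurableSpace.comap (ξ k) inferInstance

/-- The event that the walk with steps `ξ` visits `[-C, C]` at some time in `T`. -/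
def visits {Ω : Type*} (ξ : ℕ → Ω → ℝ) (C : ℝ) (T : Set ℕ) : Set Ω :=
  {ω | ∃ n ∈ T, |increment ξ 0 n ω| ≤ C}

section StepAlgebra

variable {Ω : Type*} {ξ : ℕ → Ω → ℝ}

theorem increment_add_increment {l m n : ℕ} (hlm : l ≤ m) (hmn : m ≤ n) (ω : Ω) :
    increment ξ l m ω + increment ξ m n ω = increment ξ l n ω :=
  Finset.sum_Ico_consecutive _ hlm hmn

theorem stepAlgebra_mono {T T' : Set ℕ} (h : T ⊆ T') : stepAlgebra ξ T ≤ stepAlgebra ξ T' :=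
  biSup_mono h

theorem stepAlgebra_le [mΩ : MeasurableSpace Ω] (hξ : ∀ k, Measurable (ξ k)) (T : Set ℕ) :
    stepAlgebra ξ T ≤ mΩ :=
  iSup₂_le fun k _ => (hξ k).comap_le

theorem measurable_increment_stepAlgebra {T : Set ℕ} {m n : ℕ} (h : Set.Ico m n ⊆ T) :
    Measurable[stepAlgebra ξ T] (increment ξ m n) := by
  let _ := stepAlgebra ξ T
  refine Finset.measurable_fun_sum _ fun k hk => ?_
  exact (comap_measurable (ξ k)).mono (le_iSup₂_of_le k (h (Finset.mem_Ico.1 hk)) le_rfl) le_rfl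

theorem measurable_increment [MeasurableSpace Ω] (hξ : ∀ k, Measurable (ξ k)) (m n : ℕ) :
    Measurable (increment ξ m n) :=
  Finset.measurable_fun_sum _ fun k _ => hξ k

theorem indep_stepAlgebra_comap_increment [MeasurableSpace Ω] {μ : Measure Ω}
    (hξ : ∀ k, Measurable (ξ k)) (hind : iIndepFun ξ μ) (m n : ℕ) :
    Indep (stepAlgebra ξ (Set.Iio m))
      (MeasurableSpace.comap (increment ξ m n) inferInstance) μ := by
  have hdisj : Disjoint (Set.Iio m) (Set.Ici m) := Set.Iio_disjoint_Ici le_rfl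
  refine indep_of_indep_of_le_right
    (indep_iSup_of_disjoint (fun k => (hξ k).comap_le) hind hdisj) ?_
  exact (measurable_increment_stepAlgebra Set.Ico_subset_Ici_self).comap_le

theorem visits_mono {C : ℝ} {T T' : Set ℕ} (h : T ⊆ T') : visits ξ C T ⊆ visits ξ C T' :=
  fun _ ⟨n, hn, hC⟩ => ⟨n, h hn, hC⟩

theorem measurableSet_visits [MeasurableSpace Ω] {T : Set ℕ}
    (hT : ∀ n ∈ T, Measurable (increment ξ 0 n)) (C : ℝ) : MeasurableSet (visits ξ C T) := by
  have heq : visits ξ C T = ⋃ n ∈ T, {ω | |increment ξ 0 n ω| ≤ C} := by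
    ext ω; simp [visits]
  rw [heq]
  exact MeasurableSet.biUnion T.to_countable fun n hn =>
    measurableSet_le (hT n hn).abs measurable_const

theorem measurableSet_stepAlgebra_visits {T : Set ℕ} {m : ℕ} (hT : T ⊆ Set.Iic m) (C : ℝ) :
    MeasurableSet[stepAlgebra ξ (Set.Iio m)] (visits ξ C T) :=
  @measurableSet_visits _ _ (stepAlgebra ξ (Set.Iio m)) _ (fun _ hn =>
    measurable_increment_stepAlgebra
      (Set.Ico_subset_Iio_self.trans (Set.Iio_subset_Iio (hT hn)))) C

end StepAlgebra

section Recurrence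

variable {Ω : Type*} [MeasurableSpace Ω] {μ : Measure Ω} [IsFiniteMeasure μ]
  {ξ : ℕ → Ω → ℝ}

theorem setLIntegral_comp_increment (hξ : ∀ k, Measurable (ξ k)) (hind : iIndepFun ξ μ)
    {m n : ℕ} (hmn : m ≤ n) {B : Set Ω} (hB : MeasurableSet[stepAlgebra ξ (Set.Iio m)] B)
    {f : ℝ → ℝ≥0∞} (hf : Measurable f) :
    ∫⁻ ω in B, f (increment ξ 0 n ω) ∂μ =
      ∫⁻ ω in B, ∫⁻ ω', f (increment ξ 0 m ω + increment ξ m n ω') ∂μ ∂μ := by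
  have hpast : Measurable[stepAlgebra ξ (Set.Iio m)] (increment ξ 0 m) :=
    measurable_increment_stepAlgebra Set.Ico_subset_Iio_self
  rw [← setLIntegral_prodMk_eq_of_indep (stepAlgebra_le hξ _) hpast (measurable_increment hξ m n)
    (indep_stepAlgebra_comap_increment hξ hind m n) hB (f := fun z => f (z.1 + z.2)) (by fun_prop)]
  simp only [increment_add_increment (Nat.zero_le m) hmn]

theorem setLIntegral_sum_comp_increment (hξ : ∀ k, Measurable (ξ k)) (hind : iIndepFun ξ μ)
    {m p r : ℕ} (hmp : m ≤ p) {B : Set Ω} (hB : MeasurableSet[stepAlgebra ξ (Set.Iio m)] B)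
    {f : ℝ → ℝ≥0∞} (hf : Measurable f) :
    ∫⁻ ω in B, ∑ n ∈ Finset.Ico p r, f (increment ξ 0 n ω) ∂μ =
      ∫⁻ ω in B, ∑ n ∈ Finset.Ico p r,
        ∫⁻ ω', f (increment ξ 0 m ω + increment ξ m n ω') ∂μ ∂μ := by
  have hmeas := measurable_increment hξ
  rw [lintegral_finsetSum, lintegral_finsetSum]
  · exact Finset.sum_congr rfl fun n hn =>
      setLIntegral_comp_increment hξ hind (hmp.trans (Finset.mem_Ico.1 hn).1) hB hf
  · intro n _
    have hf' : Measurable fun z : Ω × Ω => f (increment ξ 0 m z.1 + increment ξ m n z.2) :=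
      hf.comp (((hmeas 0 m).comp measurable_fst).add ((hmeas m n).comp measurable_snd))
    exact hf'.lintegral_prod_right'
  · exact fun n _ => hf.comp (hmeas 0 n)

/-- Decomposition at the first visit: nothing is collected before it, and at most `D` in expectation
from it on. -/
theorem setLIntegral_sum_le_mul_measure_visits (hξ : ∀ k, Measurable (ξ k)) (hind : iIndepFun ξ μ)
    {C : ℝ} {f : ℝ → ℝ≥0∞} (hf : Measurable f) (hsupp : ∀ x, C < |x| → f x = 0)
    {p r : ℕ} (hpr : p ≤ r) {D : ℝ≥0∞}
    (hD : ∀ m ∈ Set.Ico p r, ∀ y,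
      ∑ n ∈ Finset.Ico m r, ∫⁻ ω, f (y + increment ξ m n ω) ∂μ ≤ D)
    {B : Set Ω} (hB : MeasurableSet[stepAlgebra ξ (Set.Iio p)] B) :
    ∫⁻ ω in B, ∑ n ∈ Finset.Ico p r, f (increment ξ 0 n ω) ∂μ ≤
      D * μ (B ∩ visits ξ C (Set.Ico p r)) := by
  induction hpr using Nat.decreasingInduction generalizing B with
  | self => simp
  | of_succ p hpr ih =>
    have hhit : MeasurableSet[stepAlgebra ξ (Set.Iio p)] (visits ξ C {p}) :=
      measurableSet_stepAlgebra_visits (by simp) C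
    have hhere : ∫⁻ ω in B ∩ visits ξ C {p}, ∑ n ∈ Finset.Ico p r, f (increment ξ 0 n ω) ∂μ ≤
        D * μ (B ∩ visits ξ C {p}) := by
      rw [setLIntegral_sum_comp_increment hξ hind le_rfl (hB.inter hhit) hf, ← setLIntegral_const]
      exact lintegral_mono fun ω => hD p ⟨le_rfl, hpr⟩ _
    have hlater : ∫⁻ ω in B \ visits ξ C {p}, ∑ n ∈ Finset.Ico p r, f (increment ξ 0 n ω) ∂μ ≤
        D * μ ((B \ visits ξ C {p}) ∩ visits ξ C (Set.Ico (p + 1) r)) := by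
      refine le_trans (le_of_eq ?_) (ih (fun m hm => hD m ⟨p.le_succ.trans hm.1, hm.2⟩)
        (stepAlgebra_mono (Set.Iio_subset_Iio p.le_succ) _ (hB.diff hhit)))
      refine setLIntegral_congr_fun (stepAlgebra_le hξ _ _ (hB.diff hhit)) fun ω hω => ?_
      have hmiss : C < |increment ξ 0 p ω| := by
        simpa [visits] using hω.2
      rw [Finset.sum_eq_sum_Ico_succ_bot hpr, hsupp _ hmiss, zero_add]
    have hhit' := stepAlgebra_le hξ _ _ hhit
    rw [← lintegral_inter_add_sdiff _ _ hhit',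
      ← measure_inter_add_sdiff (B ∩ visits ξ C (Set.Ico p r)) hhit', mul_add]
    refine add_le_add (hhere.trans ?_) (hlater.trans ?_)
    · gcongr D * μ ?_
      exact fun ω hω => ⟨⟨hω.1, visits_mono (by simpa using hpr) hω.2⟩, hω.2⟩
    · gcongr D * μ ?_
      exact fun ω hω => ⟨⟨hω.1.1, visits_mono (Set.Ico_subset_Ico_left p.le_succ) hω.2⟩, hω.1.2⟩

theorem measure_le_measure_inter_visits (hξ : ∀ k, Measurable (ξ k)) (hind : iIndepFun ξ μ)
    {C : ℝ} {f : ℝ → ℝ≥0∞} (hf : Measurable f) (hsupp : ∀ x, C < |x| → f x = 0)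
    {M p r : ℕ} (hMp : M ≤ p) (hpr : p ≤ r) {δ D : ℝ≥0∞} (hD0 : D ≠ 0) (hDtop : D ≠ ∞)
    (hup : ∀ m ∈ Set.Ico p r, ∀ y,
      ∑ n ∈ Finset.Ico m r, ∫⁻ ω, f (y + increment ξ m n ω) ∂μ ≤ D)
    {B : Set Ω} (hB : MeasurableSet[stepAlgebra ξ (Set.Iio M)] B)
    (hlow : ∀ ω ∈ B, δ * D ≤
      ∑ n ∈ Finset.Ico p r, ∫⁻ ω', f (increment ξ 0 M ω + increment ξ M n ω') ∂μ) :
    δ * μ B ≤ μ (B ∩ visits ξ C (Set.Ici M)) := by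
  have hBp : MeasurableSet[stepAlgebra ξ (Set.Iio p)] B :=
    stepAlgebra_mono (Set.Iio_subset_Iio hMp) _ hB
  have hvisits : visits ξ C (Set.Ico p r) ⊆ visits ξ C (Set.Ici M) :=
    visits_mono fun n hn => hMp.trans hn.1
  refine (ENNReal.mul_le_mul_iff_right hD0 hDtop).1 ?_
  calc D * (δ * μ B) = ∫⁻ _ in B, δ * D ∂μ := by
        rw [setLIntegral_const]; ring
    _ ≤ ∫⁻ ω in B, ∑ n ∈ Finset.Ico p r,
          ∫⁻ ω', f (increment ξ 0 M ω + increment ξ M n ω') ∂μ ∂μ :=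
        setLIntegral_mono' (stepAlgebra_le hξ _ _ hB) hlow
    _ = ∫⁻ ω in B, ∑ n ∈ Finset.Ico p r, f (increment ξ 0 n ω) ∂μ :=
        (setLIntegral_sum_comp_increment hξ hind hMp hB hf).symm
    _ ≤ D * μ (B ∩ visits ξ C (Set.Ico p r)) :=
        setLIntegral_sum_le_mul_measure_visits hξ hind hf hsupp hpr hup hBp
    _ ≤ D * μ (B ∩ visits ξ C (Set.Ici M)) := by gcongr

theorem ae_frequently_abs_increment_le_of_hitting (hξ : ∀ k, Measurable (ξ k)) {C : ℝ} {δ : ℝ≥0∞}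
    (hδ : δ ≠ 0)
    (hhit : ∀ M B, MeasurableSet[stepAlgebra ξ (Set.Iio M)] B →
      δ * μ B ≤ μ (B ∩ visits ξ C (Set.Ici M))) :
    ∀ᵐ ω ∂μ, ∃ᶠ n in atTop, |increment ξ 0 n ω| ≤ C := by
  suffices h : ∀ m, μ (visits ξ C (Set.Ici m))ᶜ = 0 by
    filter_upwards [ae_all_iff.2 fun m => measure_eq_zero_iff_ae_notMem.1 (h m)] with ω hω
    exact frequently_atTop.2 fun m => not_not.1 (hω m)
  intro m
  have hpast : ∀ M, MeasurableSet[stepAlgebra ξ (Set.Iio M)] (visits ξ C (Set.Ico m M)) :=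
    fun M => measurableSet_stepAlgebra_visits (fun n hn => (Set.mem_Ico.1 hn).2.le) C
  have hle : ∀ M ≥ m, δ * μ (visits ξ C (Set.Ici m))ᶜ ≤
      μ (visits ξ C (Set.Ici m) \ visits ξ C (Set.Ico m M)) := by
    intro M hM
    calc δ * μ (visits ξ C (Set.Ici m))ᶜ ≤ δ * μ (visits ξ C (Set.Ico m M))ᶜ := by
          gcongr
          exact visits_mono Set.Ico_subset_Ici_self
      _ ≤ μ ((visits ξ C (Set.Ico m M))ᶜ ∩ visits ξ C (Set.Ici M)) := hhit M _ (hpast M).compl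
      _ ≤ μ (visits ξ C (Set.Ici m) \ visits ξ C (Set.Ico m M)) := by
          rw [Set.inter_comm]
          exact measure_mono (Set.inter_subset_inter_left _ (visits_mono (Set.Ici_subset_Ici.2 hM)))
  have hlim : Tendsto (fun M => μ (visits ξ C (Set.Ici m) \ visits ξ C (Set.Ico m M))) atTop
      (𝓝 0) := by
    have hempty : ⋂ M, visits ξ C (Set.Ici m) \ visits ξ C (Set.Ico m M) = ∅ := by
      refine Set.eq_empty_of_forall_notMem fun ω hω => ?_
      rw [Set.mem_iInter] at hω
      obtain ⟨n, hn, hC⟩ := (hω 0).1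
      exact (hω (n + 1)).2 ⟨n, ⟨hn, n.lt_succ_self⟩, hC⟩
    have hvisits : MeasurableSet (visits ξ C (Set.Ici m)) :=
      measurableSet_visits (fun n _ => measurable_increment hξ 0 n) C
    rw [← measure_empty (μ := μ), ← hempty]
    exact tendsto_measure_iInter_atTop
      (fun M => (hvisits.diff (stepAlgebra_le hξ _ _ (hpast M))).nullMeasurableSet)
      (fun M M' h => Set.sdiff_subset_sdiff_right (visits_mono (Set.Ico_subset_Ico_right h)))
      ⟨0, measure_ne_top _ _⟩
  have hzero : δ * μ (visits ξ C (Set.Ici m))ᶜ = 0 :=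
    le_antisymm (ge_of_tendsto hlim (eventually_atTop.2 ⟨m, hle⟩)) zero_le
  exact (mul_eq_zero.1 hzero).resolve_left hδ

theorem ae_frequently_abs_increment_le_of_windows (hξ : ∀ k, Measurable (ξ k))
    (hind : iIndepFun ξ μ)
    {C : ℝ} {f : ℝ → ℝ≥0∞} (hf : Measurable f) (hsupp : ∀ x, C < |x| → f x = 0)
    {δ : ℝ≥0∞} (hδ : δ ≠ 0)
    (hwindow : ∀ (L : ℝ) (M : ℕ), ∃ p r : ℕ, ∃ D : ℝ≥0∞, M ≤ p ∧ p ≤ r ∧ D ≠ 0 ∧ D ≠ ∞ ∧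
      (∀ m ∈ Set.Ico p r, ∀ y,
        ∑ n ∈ Finset.Ico m r, ∫⁻ ω, f (y + increment ξ m n ω) ∂μ ≤ D) ∧
      ∀ x, |x| ≤ L → δ * D ≤ ∑ n ∈ Finset.Ico p r, ∫⁻ ω, f (x + increment ξ M n ω) ∂μ) :
    ∀ᵐ ω ∂μ, ∃ᶠ n in atTop, |increment ξ 0 n ω| ≤ C := by
  refine ae_frequently_abs_increment_le_of_hitting hξ hδ fun M B hB => ?_
  have hbound : ∀ L : ℕ, δ * μ (B ∩ increment ξ 0 M ⁻¹' Set.Icc (-L) L) ≤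
      μ (B ∩ visits ξ C (Set.Ici M)) := by
    intro L
    obtain ⟨p, r, D, hMp, hpr, hD0, hDtop, hup, hlow⟩ := hwindow L M
    have hS : Measurable[stepAlgebra ξ (Set.Iio M)] (increment ξ 0 M) :=
      measurable_increment_stepAlgebra Set.Ico_subset_Iio_self
    refine (measure_le_measure_inter_visits hξ hind hf hsupp hMp hpr hD0 hDtop hup
      (hB.inter (hS measurableSet_Icc)) fun ω hω => hlow _ (abs_le.2 hω.2)).trans ?_
    gcongr
    exact Set.inter_subset_left
  have hmono : Monotone fun L : ℕ => B ∩ increment ξ 0 M ⁻¹' Set.Icc (-L) L := fun L L' h => by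
    have h' : (L : ℝ) ≤ L' := by exact_mod_cast h
    exact Set.inter_subset_inter_right _
      (Set.preimage_mono (Set.Icc_subset_Icc (neg_le_neg h') h'))
  have hunion : ⋃ L : ℕ, B ∩ increment ξ 0 M ⁻¹' Set.Icc (-L) L = B := by
    rw [← Set.inter_iUnion, Set.inter_eq_left]
    intro ω _
    obtain ⟨L, hL⟩ := exists_nat_ge |increment ξ 0 M ω|
    exact Set.mem_iUnion.2 ⟨L, abs_le.1 hL⟩
  calc δ * μ B = ⨆ L : ℕ, δ * μ (B ∩ increment ξ 0 M ⁻¹' Set.Icc (-L) L) := by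
        rw [← ENNReal.mul_iSup, ← hmono.measure_iUnion, hunion]
    _ ≤ μ (B ∩ visits ξ C (Set.Ici M)) := iSup_le hbound

end Recurrence

section Fourier

theorem schwartz_eq_integral_fourier (f : 𝓢(ℝ, ℂ)) (x : ℝ) :
    f x = ∫ v, 𝓕 f v * Complex.exp ((2 * Real.pi * v * x : ℝ) * Complex.I) := by
  have hinv : f x = 𝓕⁻ (⇑(𝓕 f : 𝓢(ℝ, ℂ))) x := by
    rw [← SchwartzMap.fourierInv_coe, FourierTransform.fourierInv_fourier_eq]
  rw [hinv, Real.fourierInv_eq']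
  refine integral_congr_ae (Eventually.of_forall fun v => ?_)
  simp only [smul_eq_mul, RCLike.inner_apply, conj_trivial]
  rw [mul_comm]
  congr 4
  ring

theorem integral_schwartz_add_eq_integral_fourier_mul_charFun (f : 𝓢(ℝ, ℂ)) (ν : Measure ℝ)
    [IsFiniteMeasure ν] (y : ℝ) :
    ∫ x, f (y + x) ∂ν = ∫ v, 𝓕 f v * Complex.exp ((2 * Real.pi * v * y : ℝ) * Complex.I) *
      charFun ν (2 * Real.pi * v) := by
  have hint : Integrable (fun z : ℝ × ℝ =>
      𝓕 f z.2 * Complex.exp ((2 * Real.pi * z.2 * (y + z.1) : ℝ) * Complex.I)) (ν.prod volume) := by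
    refine ((𝓕 f).integrable.comp_snd ν).mul_bdd (c := 1) ?_ ?_
    · fun_prop
    · exact Eventually.of_forall fun z => (Complex.norm_exp_ofReal_mul_I _).le
  simp only [schwartz_eq_integral_fourier f]
  rw [integral_integral_swap hint]
  refine integral_congr_ae (Eventually.of_forall fun v => ?_)
  simp only [charFun_apply_real, ← integral_const_mul]
  refine integral_congr_ae (Eventually.of_forall fun x => ?_)
  simp only [mul_assoc, ← Complex.exp_add]
  push_cast
  congr 2
  ring

end Fourier

section Rademacher

variable {Ω : Type*} [MeasurableSpace Ω] {μ : Measure Ω} [IsProbabilityMeasure μ]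

theorem IsRademacher.ae_eq_or {Y : Ω → ℝ} (hY : IsRademacher Y μ) :
    ∀ᵐ ω ∂μ, Y ω = 1 ∨ Y ω = -1 := by
  have hone : MeasurableSet {ω | Y ω = 1} := hY.measurable (measurableSet_singleton 1)
  have hneg : MeasurableSet {ω | Y ω = -1} := hY.measurable (measurableSet_singleton (-1))
  have hdisj : Disjoint {ω | Y ω = 1} {ω | Y ω = -1} := by
    rw [Set.disjoint_left]
    intro ω hω hω'
    simp only [Set.mem_ofPred_eq] at hω hω'
    linarith
  have hunion : μ ({ω | Y ω = 1} ∪ {ω | Y ω = -1}) = 1 := by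
    rw [measure_union hdisj hneg, hY.prob_one, hY.prob_neg_one]
    exact ENNReal.add_halves 1
  exact (prob_compl_eq_zero_iff (hone.union hneg)).2 hunion

theorem IsRademacher.map_eq {Y : Ω → ℝ} (hY : IsRademacher Y μ) :
    μ.map Y = (1 / 2 : ℝ≥0∞) • Measure.dirac 1 + (1 / 2 : ℝ≥0∞) • Measure.dirac (-1) := by
  have hne : (1 : ℝ) ≠ -1 := by norm_num
  have hmap := (Measure.ae_eq_or_eq_iff_map_eq_dirac_add_dirac hY.measurable.aemeasurable hne).1
    hY.ae_eq_or
  have hone : μ (Y ⁻¹' {1}) = 1 / 2 := hY.prob_one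
  have hneg : μ (Y ⁻¹' {-1}) = 1 / 2 := hY.prob_neg_one
  rw [hmap, hone, hneg]

theorem IsRademacher.charFun_map_const_mul {Y : Ω → ℝ} (hY : IsRademacher Y μ) (b t : ℝ) :
    charFun (μ.map fun ω => b * Y ω) t = Real.cos (b * t) := by
  have hint (x : ℝ) : Integrable (fun s : ℝ => Complex.exp ((b * t : ℝ) * s * Complex.I))
      ((1 / 2 : ℝ≥0∞) • Measure.dirac x) :=
    (integrable_dirac (by simp)).smul_measure (by simp)
  rw [charFun_map_mul_comp hY.measurable.aemeasurable, hY.map_eq, charFun_apply_real,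
    integral_add_measure (hint 1) (hint (-1)), integral_smul_measure, integral_smul_measure,
    integral_dirac, integral_dirac, Complex.ofReal_cos, Complex.cos]
  simp only [one_div, ENNReal.toReal_inv, ENNReal.toReal_ofNat, Complex.ofReal_mul,
    Complex.ofReal_one, mul_one, Complex.real_smul, Complex.ofReal_inv, Complex.ofReal_ofNat,
    Complex.ofReal_neg, mul_neg, neg_mul]
  ring

end Rademacher

section Trigonometry

theorem sin_sq_le_two_mul_sin_sq_add_sin_sq (x d : ℝ) :
    Real.sin d ^ 2 ≤ 2 * (Real.sin x ^ 2 + Real.sin (x + d) ^ 2) := by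
  have hd : Real.sin d = Real.sin (x + d) * Real.cos x - Real.cos (x + d) * Real.sin x := by
    rw [← Real.sin_sub, add_sub_cancel_left]
  have hdouble : Real.sin d ^ 2 ≤
      2 * (Real.sin (x + d) ^ 2 * Real.cos x ^ 2 + Real.cos (x + d) ^ 2 * Real.sin x ^ 2) := by
    rw [hd]
    linarith [sq_nonneg (Real.sin (x + d) * Real.cos x + Real.cos (x + d) * Real.sin x)]
  have h1 := mul_le_of_le_one_right (sq_nonneg (Real.sin (x + d))) (Real.cos_sq_le_one x)
  have h2 := mul_le_of_le_one_left (sq_nonneg (Real.sin x)) (Real.cos_sq_le_one (x + d))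
  linarith

theorem half_le_sin {x : ℝ} (h0 : 0 ≤ x) (h1 : x ≤ 1) : x / 2 ≤ Real.sin x := by
  have hjordan : 2 / Real.pi * x ≤ Real.sin x := Real.mul_le_sin h0 (by linarith [Real.pi_gt_three])
  have hpi : 1 / 2 ≤ 2 / Real.pi := by
    rw [div_le_div_iff₀ (by norm_num) Real.pi_pos]
    linarith [Real.pi_le_four]
  nlinarith

theorem abs_cos_le_exp_neg_sin_sq (x : ℝ) : |Real.cos x| ≤ Real.exp (-(Real.sin x ^ 2) / 2) := by
  refine abs_le_of_sq_le_sq ?_ (Real.exp_pos _).le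
  calc Real.cos x ^ 2 = -(Real.sin x ^ 2) + 1 := by rw [Real.cos_sq']; ring
    _ ≤ Real.exp (-(Real.sin x ^ 2)) := Real.add_one_le_exp _
    _ = Real.exp (-(Real.sin x ^ 2) / 2) ^ 2 := by rw [← Real.exp_nat_mul]; congr 1; push_cast; ring

theorem prod_abs_cos_le_exp_neg_sum_sin_sq {ι : Type*} (s : Finset ι) (x : ι → ℝ) :
    ∏ k ∈ s, |Real.cos (x k)| ≤ Real.exp (-(∑ k ∈ s, Real.sin (x k) ^ 2) / 2) := by
  rw [← Finset.sum_neg_distrib, Finset.sum_div, Real.exp_sum]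
  exact Finset.prod_le_prod (fun _ _ => abs_nonneg _) fun k _ => abs_cos_le_exp_neg_sin_sq _

theorem one_sub_sum_le_prod {ι : Type*} (s : Finset ι) {x : ι → ℝ}
    (h0 : ∀ k ∈ s, 0 ≤ x k) (h1 : ∀ k ∈ s, x k ≤ 1) : 1 - ∑ k ∈ s, x k ≤ ∏ k ∈ s, (1 - x k) := by
  classical
  induction s using Finset.induction_on with
  | empty => simp
  | insert a s ha ih =>
    rw [Finset.forall_mem_insert] at h0 h1
    have hsum : 0 ≤ ∑ k ∈ s, x k := Finset.sum_nonneg h0.2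
    rw [Finset.sum_insert ha, Finset.prod_insert ha]
    calc 1 - (x a + ∑ k ∈ s, x k) ≤ (1 - x a) * (1 - ∑ k ∈ s, x k) := by
          nlinarith [mul_nonneg h0.1 hsum]
      _ ≤ (1 - x a) * ∏ k ∈ s, (1 - x k) :=
          mul_le_mul_of_nonneg_left (ih h0.2 h1.2) (by linarith [h1.1])

theorem one_sub_sum_sq_div_two_le_prod_cos {ι : Type*} (s : Finset ι) {x : ι → ℝ}
    (hx : ∀ k ∈ s, |x k| ≤ 1) : 1 - (∑ k ∈ s, x k ^ 2) / 2 ≤ ∏ k ∈ s, Real.cos (x k) := by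
  have hsq : ∀ k ∈ s, x k ^ 2 ≤ 1 := fun k hk => (sq_le_one_iff_abs_le_one _).2 (hx k hk)
  rw [Finset.sum_div]
  refine (one_sub_sum_le_prod s (fun k _ => by positivity) fun k hk => by
    linarith [hsq k hk]).trans ?_
  exact Finset.prod_le_prod (fun k hk => by linarith [hsq k hk])
    fun k _ => Real.one_sub_sq_div_two_le_cos

end Trigonometry

theorem div_add_le_log_add_sub_log {x h : ℝ} (hx : 0 < x) (hh : 0 ≤ h) :
    h / (x + h) ≤ Real.log (x + h) - Real.log x := by
  have hxh : 0 < x + h := by linarith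
  have hlog := Real.one_sub_inv_le_log_of_pos (div_pos hxh hx)
  rw [Real.log_div hxh.ne' hx.ne', inv_div] at hlog
  refine le_trans (le_of_eq ?_) hlog
  field_simp
  ring

theorem log_add_sub_log_le_div {x h : ℝ} (hx : 0 < x) (hh : 0 ≤ h) :
    Real.log (x + h) - Real.log x ≤ h / x := by
  have hxh : 0 < x + h := by linarith
  have hlog := Real.log_le_sub_one_of_pos (div_pos hxh hx)
  rw [Real.log_div hxh.ne' hx.ne'] at hlog
  refine hlog.trans (le_of_eq ?_)
  field_simp
  ring

/-- The step sizes `log (k + 1)`, indexed from `0`. -/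
noncomputable def logStep (k : ℕ) : ℝ := Real.log (k + 1)

section FarFrequencies

variable {N n j h : ℕ} {t : ℝ}

/-- The two phases differ by `t * log ((k + 1 + h) / (k + 1))`, which lies in `[t h / (4 N), 1]`. -/
theorem sq_le_two_mul_sin_sq_logStep_add {k : ℕ} (hN : 0 < N) (hk : N ≤ k + 1)
    (hkh : k + 1 + h ≤ 4 * N) (ht : 0 ≤ t) (hth : t * h ≤ N) :
    (t * h / (8 * N)) ^ 2 ≤
      2 * (Real.sin (logStep k * t) ^ 2 + Real.sin (logStep (k + h) * t) ^ 2) := by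
  have hN' : (0 : ℝ) < N := by exact_mod_cast hN
  have hk' : (N : ℝ) ≤ k + 1 := by exact_mod_cast hk
  have hkh' : (k : ℝ) + 1 + h ≤ 4 * N := by exact_mod_cast hkh
  have hkpos : (0 : ℝ) < k + 1 := by positivity
  set d := (Real.log (k + 1 + h) - Real.log (k + 1)) * t
  have hphase : logStep (k + h) * t = logStep k * t + d := by
    simp only [logStep, d, Nat.cast_add, add_right_comm (k : ℝ) h 1]
    ring
  have hlow : t * h / (4 * N) ≤ d :=
    calc t * h / (4 * N) ≤ t * h / (k + 1 + h) := by gcongr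
      _ = h / (k + 1 + h) * t := by ring
      _ ≤ d := mul_le_mul_of_nonneg_right (div_add_le_log_add_sub_log hkpos h.cast_nonneg) ht
  have hup : d ≤ 1 :=
    calc d ≤ h / (k + 1) * t :=
          mul_le_mul_of_nonneg_right (log_add_sub_log_le_div hkpos h.cast_nonneg) ht
      _ = t * h / (k + 1) := by ring
      _ ≤ N / N := by gcongr
      _ = 1 := div_self hN'.ne'
  have hd0 : 0 ≤ d := le_trans (by positivity) hlow
  have hsin : t * h / (8 * N) ≤ Real.sin d :=
    calc t * h / (8 * N) = t * h / (4 * N) / 2 := by ring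
      _ ≤ d / 2 := by gcongr
      _ ≤ Real.sin d := half_le_sin hd0 hup
  rw [hphase]
  exact (pow_le_pow_left₀ (by positivity) hsin 2).trans (sin_sq_le_two_mul_sin_sq_add_sin_sq _ _)

theorem sum_sin_sq_logStep_ge (hN : 0 < N) (hn : N ≤ n) (hnj : n + j ≤ 4 * N)
    (hh : 2 * h ≤ j) (ht : 0 ≤ t) (hth : t * h ≤ N) :
    (j : ℝ) / 8 * (t * h / (8 * N)) ^ 2 ≤
      ∑ k ∈ Finset.Ico n (n + j), Real.sin (logStep k * t) ^ 2 := by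
  set a : ℕ → ℝ := fun k => Real.sin (logStep k * t) ^ 2
  have ha : ∀ k, 0 ≤ a k := fun k => sq_nonneg _
  have hpairs : ∑ _k ∈ Finset.Ico n (n + (j - h)), (t * h / (8 * N)) ^ 2 ≤
      2 * (∑ k ∈ Finset.Ico n (n + (j - h)), a k +
        ∑ k ∈ Finset.Ico n (n + (j - h)), a (k + h)) := by
    rw [← Finset.sum_add_distrib, Finset.mul_sum]
    refine Finset.sum_le_sum fun k hk => ?_
    rw [Finset.mem_Ico] at hk
    exact sq_le_two_mul_sin_sq_logStep_add hN (by omega) (by omega) ht hth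
  have hleft : ∑ k ∈ Finset.Ico n (n + (j - h)), a k ≤ ∑ k ∈ Finset.Ico n (n + j), a k :=
    Finset.sum_le_sum_of_subset_of_nonneg (Finset.Ico_subset_Ico_right (by omega))
      fun k _ _ => ha k
  have hright : ∑ k ∈ Finset.Ico n (n + (j - h)), a (k + h) ≤ ∑ k ∈ Finset.Ico n (n + j), a k := by
    rw [Finset.sum_Ico_add' a]
    exact Finset.sum_le_sum_of_subset_of_nonneg (Finset.Ico_subset_Ico (by omega) (by omega))
      fun k _ _ => ha k
  have hcard : (j : ℝ) / 2 ≤ (j - h : ℕ) := by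
    rw [div_le_iff₀ two_pos]
    exact_mod_cast (by omega : j ≤ (j - h) * 2)
  rw [Finset.sum_const, Nat.card_Ico, nsmul_eq_mul, Nat.add_sub_cancel_left] at hpairs
  have hcard' := mul_le_mul_of_nonneg_right hcard (sq_nonneg (t * h / (8 * N)))
  linarith

end FarFrequencies

/-- The logarithmic scale of the times up to `4 * u ^ 4`; the steps at times in
`[u ^ 4, 4 * u ^ 4]` are comparable to it. Times are measured by their fourth root `u`, so that the
powers `N ^ (1 / 2)` and `N ^ (3 / 4)` of `N = u ^ 4` are again natural numbers. -/
noncomputable def logScale (u : ℕ) : ℝ := Real.log (4 * u ^ 4)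

theorem logStep_le_logScale {u k : ℕ} (hk : k + 1 ≤ 4 * u ^ 4) : logStep k ≤ logScale u :=
  Real.log_le_log (by positivity) (by exact_mod_cast hk)

/-- The scale `u` is so large that powers of `logScale u` are negligible against `u`. -/
structure IsLargeScale (u : ℕ) : Prop where
  pos : 0 < u
  pow_logScale_le : 10000 * logScale u ^ 3 ≤ u

theorem eventually_isLargeScale : ∀ᶠ u : ℕ in atTop, IsLargeScale u := by
  have hlittle := (Real.isLittleO_pow_log_id_atTop (n := 3)).comp_tendsto
    (tendsto_natCast_atTop_atTop (R := ℝ))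
  filter_upwards [hlittle.def (c := 1 / 1250000) (by norm_num), eventually_ge_atTop 4] with u hu hu4
  have hu4' : (4 : ℝ) ≤ u := by exact_mod_cast hu4
  have hlog0 : 0 ≤ Real.log u := Real.log_natCast_nonneg u
  refine ⟨by omega, ?_⟩
  have hscale : logScale u ≤ 5 * Real.log u := by
    have h4 : Real.log 4 ≤ Real.log u := Real.log_le_log (by norm_num) hu4'
    rw [logScale, Real.log_mul (by norm_num) (by positivity), Real.log_pow]
    push_cast
    linarith
  have hscale0 : 0 ≤ logScale u := Real.log_nonneg (by
    have := one_le_pow₀ (show (1 : ℝ) ≤ u by linarith) (n := 4)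
    linarith)
  simp only [Function.comp_apply, id_eq, Real.norm_eq_abs, abs_pow, abs_of_nonneg hlog0,
    Nat.abs_cast] at hu
  calc 10000 * logScale u ^ 3 ≤ 10000 * (5 * Real.log u) ^ 3 := by gcongr
    _ = 1250000 * Real.log u ^ 3 := by ring
    _ ≤ u := by linarith

namespace IsLargeScale

variable {u : ℕ}

theorem exp_logScale (hu : IsLargeScale u) : Real.exp (logScale u) = 4 * u ^ 4 := by
  have := hu.pos
  exact Real.exp_log (by positivity)

theorem one_le_logScale (hu : IsLargeScale u) : 1 ≤ logScale u := by
  have hu1 : (1 : ℝ) ≤ u := by exact_mod_cast hu.pos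
  rw [← Real.exp_le_exp, hu.exp_logScale]
  linarith [Real.exp_one_lt_d9, one_le_pow₀ hu1 (n := 4)]

theorem pow_logScale_le_cast (hu : IsLargeScale u) {i : ℕ} (hi : i ≤ 3) :
    10000 * logScale u ^ i ≤ u :=
  le_trans (by gcongr; exact hu.one_le_logScale) hu.pow_logScale_le

theorem le_cast (hu : IsLargeScale u) : (10000 : ℝ) ≤ u := by
  simpa using hu.pow_logScale_le_cast (Nat.zero_le 3)

theorem half_logScale_le_log (hu : IsLargeScale u) : logScale u / 2 ≤ Real.log (u ^ 4) := by
  have hu0 := hu.le_cast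
  have hpow : (u : ℝ) ≤ u ^ 4 := le_self_pow₀ (by linarith) (by norm_num)
  have h4 : Real.log 4 ≤ Real.log (u ^ 4) := Real.log_le_log (by norm_num) (by linarith)
  rw [logScale, Real.log_mul (by norm_num) (by positivity)]
  linarith

theorem half_logScale_le_logStep (hu : IsLargeScale u) {k : ℕ} (hk : u ^ 4 ≤ k + 1) :
    logScale u / 2 ≤ logStep k := by
  have := hu.pos
  exact hu.half_logScale_le_log.trans (Real.log_le_log (by positivity) (by exact_mod_cast hk))

/-- The shift is half of the window, or about `u ^ 4 / (2 * t)` if this is shorter. -/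
theorem exists_shift (hu : IsLargeScale u) {j : ℕ} {t : ℝ} (hj : u ^ 3 ≤ j)
    (ht : 1 / logScale u ≤ t) (ht' : t ≤ u ^ 4 / 4) :
    ∃ h : ℕ, 2 * h ≤ j ∧ t * h ≤ u ^ 4 ∧ (u : ℝ) ^ 3 / (3 * logScale u) ≤ t * h := by
  have hu0 := hu.le_cast
  have hl := hu.one_le_logScale
  have ht0 : 0 < t := lt_of_lt_of_le (by positivity) ht
  have hj' : (u : ℝ) ^ 3 ≤ j := by exact_mod_cast hj
  rcases le_or_gt (t * j) (u ^ 4) with hshort | hlong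
  · have hhalf : ((j / 2 : ℕ) : ℝ) ≤ j := by exact_mod_cast Nat.div_le_self j 2
    have hthird : (j : ℝ) / 3 ≤ (j / 2 : ℕ) := by
      have hu2 : 2 ≤ u := by exact_mod_cast (by linarith : (2 : ℝ) ≤ u)
      have hj2 : 2 ≤ j := hu2.trans ((Nat.le_self_pow (by norm_num) u).trans hj)
      rw [div_le_iff₀ three_pos]
      exact_mod_cast (by omega : j ≤ j / 2 * 3)
    refine ⟨j / 2, by omega, hshort.trans' (by gcongr), ?_⟩
    calc (u : ℝ) ^ 3 / (3 * logScale u) = 1 / logScale u * (u ^ 3 / 3) := by ring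
      _ ≤ t * (j / 3) := by gcongr
      _ ≤ t * (j / 2 : ℕ) := by gcongr
  · set h := ⌊(u : ℝ) ^ 4 / (2 * t)⌋₊
    have hfloor : (h : ℝ) ≤ u ^ 4 / (2 * t) := Nat.floor_le (by positivity)
    have hfloor' : (u : ℝ) ^ 4 / (2 * t) < h + 1 := Nat.lt_floor_add_one _
    rw [le_div_iff₀ (by positivity)] at hfloor
    rw [div_lt_iff₀ (by positivity)] at hfloor'
    refine ⟨h, ?_, by linarith, ?_⟩
    · have hlt : t * (2 * h) ≤ t * j := by linarith
      exact_mod_cast le_of_mul_le_mul_left hlt ht0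
    · calc (u : ℝ) ^ 3 / (3 * logScale u) ≤ (u : ℝ) ^ 3 / 1 := by gcongr; linarith
        _ ≤ (u : ℝ) ^ 4 / 4 := by nlinarith [pow_pos (by linarith : (0 : ℝ) < u) 3]
        _ ≤ t * h := by linarith

theorem two_mul_logScale_le_sum_sin_sq (hu : IsLargeScale u) {n j : ℕ} {t : ℝ} (hn : u ^ 4 ≤ n)
    (hnj : n + j ≤ 4 * u ^ 4) (hj : u ^ 3 ≤ j) (ht : 1 / logScale u ≤ t) (ht' : t ≤ u ^ 4 / 4) :
    2 * logScale u ≤ ∑ k ∈ Finset.Ico n (n + j), Real.sin (logStep k * t) ^ 2 := by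
  have hl := hu.one_le_logScale
  have hu0 : (0 : ℝ) < u := by exact_mod_cast hu.pos
  have hj' : (u : ℝ) ^ 3 ≤ j := by exact_mod_cast hj
  obtain ⟨h, hhj, hth, hshift⟩ := hu.exists_shift hj ht ht'
  calc 2 * logScale u ≤ u / (4608 * logScale u ^ 2) := by
        rw [le_div_iff₀ (by positivity)]
        nlinarith [hu.pow_logScale_le, pow_pos (by linarith : 0 < logScale u) 3]
    _ = (u : ℝ) ^ 3 / 8 * (u ^ 3 / (3 * logScale u) / (8 * u ^ 4)) ^ 2 := by
        field_simp
        norm_num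
    _ ≤ j / 8 * (t * h / (8 * (u ^ 4 : ℕ))) ^ 2 := by
        push_cast
        gcongr
    _ ≤ ∑ k ∈ Finset.Ico n (n + j), Real.sin (logStep k * t) ^ 2 :=
        sum_sin_sq_logStep_ge (pow_pos hu.pos 4) hn hnj hhj
          (le_trans (by positivity) ht) (by exact_mod_cast hth)

theorem prod_abs_cos_le_of_far (hu : IsLargeScale u) {n j : ℕ} {t : ℝ} (hn : u ^ 4 ≤ n)
    (hnj : n + j ≤ 4 * u ^ 4) (hj : u ^ 3 ≤ j) (ht : 1 / logScale u ≤ |t|) :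
    ∏ k ∈ Finset.Ico n (n + j), |Real.cos (logStep k * t)| ≤ (1 + 4 * |t|) / u ^ 4 := by
  have hu0 : (0 : ℝ) < u := by exact_mod_cast hu.pos
  rcases le_or_gt |t| (u ^ 4 / 4) with hmid | hlarge
  · have habs : ∀ k, Real.sin (logStep k * |t|) ^ 2 = Real.sin (logStep k * t) ^ 2 := fun k => by
      rcases abs_choice t with h | h <;> simp [h]
    have hsum := hu.two_mul_logScale_le_sum_sin_sq hn hnj hj ht hmid
    simp only [habs] at hsum
    calc ∏ k ∈ Finset.Ico n (n + j), |Real.cos (logStep k * t)|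
        ≤ Real.exp (-(∑ k ∈ Finset.Ico n (n + j), Real.sin (logStep k * t) ^ 2) / 2) :=
          prod_abs_cos_le_exp_neg_sum_sin_sq _ _
      _ ≤ Real.exp (-logScale u) := Real.exp_le_exp.2 (by linarith)
      _ = 1 / (4 * u ^ 4) := by rw [Real.exp_neg, hu.exp_logScale, one_div]
      _ ≤ (1 + 4 * |t|) / u ^ 4 := by gcongr <;> linarith [abs_nonneg t, pow_pos hu0 4]
  · calc ∏ k ∈ Finset.Ico n (n + j), |Real.cos (logStep k * t)| ≤ 1 :=
          Finset.prod_le_one (fun _ _ => abs_nonneg _) fun _ _ => Real.abs_cos_le_one _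
      _ ≤ (1 + 4 * |t|) / u ^ 4 := by rw [le_div_iff₀ (by positivity)]; linarith

theorem prod_abs_cos_le_of_near (hu : IsLargeScale u) {n j : ℕ} {t : ℝ} (hn : u ^ 4 ≤ n)
    (hnj : n + j ≤ 4 * u ^ 4) (ht : |t| ≤ 1 / logScale u) :
    ∏ k ∈ Finset.Ico n (n + j), |Real.cos (logStep k * t)| ≤
      Real.exp (-(j * logScale u ^ 2 / 32) * t ^ 2) := by
  have hl := hu.one_le_logScale
  refine (prod_abs_cos_le_exp_neg_sum_sin_sq _ _).trans (Real.exp_le_exp.2 ?_)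
  have hterm : ∀ k ∈ Finset.Ico n (n + j),
      logScale u ^ 2 * t ^ 2 / 16 ≤ Real.sin (logStep k * t) ^ 2 := by
    intro k hk
    rw [Finset.mem_Ico] at hk
    have hlow : logScale u / 2 ≤ logStep k := hu.half_logScale_le_logStep (by omega)
    have hup : logStep k ≤ logScale u := logStep_le_logScale (by omega)
    have hphase : logStep k * |t| ≤ 1 := by
      calc logStep k * |t| ≤ logScale u * (1 / logScale u) := by gcongr
        _ = 1 := mul_one_div_cancel (by positivity)
    have hphase0 : 0 ≤ logStep k * |t| := mul_nonneg (by linarith) (abs_nonneg t)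
    calc logScale u ^ 2 * t ^ 2 / 16 = (logScale u / 2 * |t| / 2) ^ 2 := by
          rw [div_pow, mul_pow, sq_abs]; ring
      _ ≤ Real.sin (logStep k * |t|) ^ 2 := by
          gcongr
          exact le_trans (by gcongr) (half_le_sin hphase0 hphase)
      _ = Real.sin (logStep k * t) ^ 2 := by rcases abs_choice t with h | h <;> simp [h]
  have hsum := Finset.card_nsmul_le_sum _ _ _ hterm
  rw [Nat.card_Ico, Nat.add_sub_cancel_left, nsmul_eq_mul] at hsum
  linarith

theorem sqrt_mul_logScale_le (hu : IsLargeScale u) {j : ℕ} (hj : j + 1 ≤ 4 * u ^ 4) :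
    √(j + 1) * logScale u ≤ u ^ 4 := by
  have hu0 := hu.le_cast
  have hl := hu.one_le_logScale
  have hsqrt : √((j : ℝ) + 1) ≤ 2 * u ^ 2 := by
    refine Real.sqrt_le_iff.2 ⟨by positivity, ?_⟩
    calc (j : ℝ) + 1 ≤ 4 * u ^ 4 := by exact_mod_cast hj
      _ = (2 * u ^ 2) ^ 2 := by ring
  have hlu : 10000 * logScale u ≤ u := by
    simpa using hu.pow_logScale_le_cast (i := 1) (by norm_num)
  calc √(j + 1) * logScale u ≤ 2 * u ^ 2 * u := by gcongr; linarith
    _ = u ^ 3 * 2 := by ring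
    _ ≤ u ^ 3 * u := by gcongr; linarith
    _ = u ^ 4 := by ring

end IsLargeScale

theorem sum_range_one_div_sqrt_le (J : ℕ) :
    ∑ j ∈ Finset.range J, 1 / √((j : ℝ) + 1) ≤ 2 * √J := by
  induction J with
  | zero => simp
  | succ J ih =>
    have hpos : 0 < √((J : ℝ) + 1) := Real.sqrt_pos.2 (by positivity)
    have hsq : √((J : ℝ) + 1) ^ 2 = √(J : ℝ) ^ 2 + 1 := by
      rw [Real.sq_sqrt (by positivity), Real.sq_sqrt (by positivity)]
    have hstep : 1 / √((J : ℝ) + 1) ≤ 2 * √((J : ℝ) + 1) - 2 * √(J : ℝ) := by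
      rw [div_le_iff₀ hpos]
      nlinarith [sq_nonneg (√((J : ℝ) + 1) - √(J : ℝ))]
    rw [Finset.sum_range_succ, Nat.cast_succ]
    linarith

theorem IsLargeScale.sum_range_le {u J : ℕ} (hu : IsLargeScale u) (hJ : J ≤ 4 * u ^ 4)
    {a : ℕ → ℝ} {K : ℝ} (hK : 0 ≤ K) (hshort : ∀ j < u ^ 3, a j ≤ 1 / √(j + 1))
    (hlong : ∀ j, u ^ 3 ≤ j → j < J → a j ≤ K / (√(j + 1) * logScale u)) :
    ∑ j ∈ Finset.range J, a j ≤ (2 + 4 * K) * (u ^ 2 / logScale u) := by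
  have hu0 := hu.le_cast
  have hl := hu.one_le_logScale
  have hsplit : ∀ j ∈ Finset.range J,
      a j ≤ (if j < u ^ 3 then 1 / √((j : ℝ) + 1) else 0) +
        K / logScale u * (1 / √((j : ℝ) + 1)) := by
    intro j hj
    split_ifs with h
    · exact (hshort j h).trans (le_add_of_nonneg_right (by positivity))
    · refine (hlong j (not_lt.1 h) (Finset.mem_range.1 hj)).trans (le_of_eq ?_)
      rw [zero_add, div_mul_div_comm, mul_one, mul_comm √_]
  have hfirst : ∑ j ∈ Finset.range J, (if j < u ^ 3 then 1 / √((j : ℝ) + 1) else 0) ≤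
      2 * (u ^ 2 / logScale u) := by
    have hsqrt : √((u : ℝ) ^ 3) ≤ u ^ 2 / logScale u := by
      have hsq := hu.pow_logScale_le_cast (i := 2) (by norm_num)
      rw [Real.sqrt_le_left (by positivity), div_pow, le_div_iff₀ (by positivity)]
      calc (u : ℝ) ^ 3 * logScale u ^ 2 ≤ (u : ℝ) ^ 3 * u := by gcongr; nlinarith
        _ = ((u : ℝ) ^ 2) ^ 2 := by ring
    rw [← Finset.sum_filter]
    calc ∑ j ∈ Finset.range J with j < u ^ 3, 1 / √((j : ℝ) + 1)
        ≤ ∑ j ∈ Finset.range (u ^ 3), 1 / √((j : ℝ) + 1) :=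
          Finset.sum_le_sum_of_subset_of_nonneg
            (fun j hj => Finset.mem_range.2 (Finset.mem_filter.1 hj).2)
            fun j _ _ => by positivity
      _ ≤ 2 * √((u ^ 3 : ℕ) : ℝ) := sum_range_one_div_sqrt_le _
      _ ≤ 2 * (u ^ 2 / logScale u) := by push_cast; gcongr
  have hsecond : ∑ j ∈ Finset.range J, 1 / √((j : ℝ) + 1) ≤ 4 * u ^ 2 := by
    have hsqrt : √(J : ℝ) ≤ 2 * u ^ 2 := by
      refine Real.sqrt_le_iff.2 ⟨by positivity, ?_⟩
      calc (J : ℝ) ≤ 4 * u ^ 4 := by exact_mod_cast hJ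
        _ = (2 * u ^ 2) ^ 2 := by ring
    linarith [sum_range_one_div_sqrt_le J]
  refine (Finset.sum_le_sum hsplit).trans ?_
  rw [Finset.sum_add_distrib, ← Finset.mul_sum]
  have := mul_le_mul_of_nonneg_left hsecond (show 0 ≤ K / logScale u by positivity)
  calc _ ≤ 2 * (u ^ 2 / logScale u) + K / logScale u * (4 * u ^ 2) := add_le_add hfirst this
    _ = (2 + 4 * K) * (u ^ 2 / logScale u) := by ring

section LittlewoodOfford

theorem centralBinom_sq_mul_le (n : ℕ) : (2 * n + 1) * n.centralBinom ^ 2 ≤ 16 ^ n := by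
  induction n with
  | zero => simp
  | succ n ih =>
    refine Nat.le_of_mul_le_mul_left ?_ (by positivity : 0 < (n + 1) ^ 2)
    calc (n + 1) ^ 2 * ((2 * (n + 1) + 1) * (n + 1).centralBinom ^ 2)
        = (2 * n + 3) * ((n + 1) * (n + 1).centralBinom) ^ 2 := by ring
      _ = 4 * ((2 * n + 3) * (2 * n + 1)) * ((2 * n + 1) * n.centralBinom ^ 2) := by
          rw [Nat.succ_mul_centralBinom_succ]; ring
      _ ≤ 4 * (4 * (n + 1) ^ 2) * 16 ^ n := Nat.mul_le_mul (by nlinarith) ih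
      _ = (n + 1) ^ 2 * 16 ^ (n + 1) := by ring

theorem succ_mul_choose_half_sq_le (j : ℕ) : (j + 1) * j.choose (j / 2) ^ 2 ≤ 4 ^ j := by
  obtain ⟨n, rfl | rfl⟩ := Nat.even_or_odd' j
  · rw [Nat.mul_div_cancel_left n two_pos, pow_mul]
    exact centralBinom_sq_mul_le n
  · have hbinom : (n + 1).centralBinom = 2 * (2 * n + 1).choose n := by
      rw [Nat.centralBinom, show 2 * (n + 1) = 2 * n + 1 + 1 by ring, Nat.choose_succ_succ,
        Nat.choose_symm_half n, ← two_mul]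
    have hcentral := centralBinom_sq_mul_le (n + 1)
    have hpow : 4 ^ (2 * n + 1) * 4 = 16 ^ (n + 1) := by
      rw [← pow_succ, show 2 * n + 1 + 1 = 2 * (n + 1) by ring, pow_mul]
      norm_num
    rw [hbinom] at hcentral
    rw [show (2 * n + 1) / 2 = n by omega]
    nlinarith [sq_nonneg ((2 * n + 1).choose n)]

theorem choose_half_div_two_pow_le (j : ℕ) :
    (j.choose (j / 2) : ℝ) / 2 ^ j ≤ 1 / √(j + 1) := by
  have h : ((j : ℝ) + 1) * (j.choose (j / 2) : ℝ) ^ 2 ≤ 4 ^ j := by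
    exact_mod_cast succ_mul_choose_half_sq_le j
  rw [div_le_div_iff₀ (by positivity) (by positivity), one_mul]
  refine le_of_sq_le_sq ?_ (by positivity)
  calc ((j.choose (j / 2) : ℝ) * √(j + 1)) ^ 2 = (j + 1) * (j.choose (j / 2) : ℝ) ^ 2 := by
        rw [mul_pow, Real.sq_sqrt (by positivity), mul_comm]
    _ ≤ 4 ^ j := h
    _ = (2 ^ j) ^ 2 := by rw [← pow_mul, mul_comm j 2, pow_mul]; norm_num

/-- The sign vector that is `1` on `A` and `-1` off `A`. -/
noncomputable def signVector {ι : Type*} (A : Finset ι) (i : ι) : ℝ :=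
  open Classical in if i ∈ A then 1 else -1

theorem signVector_of_mem {ι : Type*} {A : Finset ι} {i : ι} (h : i ∈ A) : signVector A i = 1 :=
  if_pos h

theorem signVector_of_notMem {ι : Type*} {A : Finset ι} {i : ι} (h : i ∉ A) :
    signVector A i = -1 :=
  if_neg h

theorem ae_exists_forall_eq_signVector {ι Ω : Type*} [Finite ι] [MeasurableSpace Ω]
    {μ : Measure Ω} [IsProbabilityMeasure μ] {Z : ι → Ω → ℝ} (hZ : ∀ i, IsRademacher (Z i) μ) :
    ∀ᵐ ω ∂μ, ∃ A : Finset ι, ∀ i, Z i ω = signVector A i := by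
  filter_upwards [ae_all_iff.2 fun i => (hZ i).ae_eq_or] with ω hω
  refine ⟨(Set.toFinite {i | Z i ω = 1}).toFinset, fun i => ?_⟩
  by_cases h : Z i ω = 1
  · rw [h, signVector_of_mem (by simpa using h)]
  · rw [(hω i).resolve_left h, signVector_of_notMem (by simpa using h)]

variable {ι : Type*} [Fintype ι] {v : ι → ℝ} {C : ℝ}

theorem sum_mul_signVector_add_le {A B : Finset ι} (hv : ∀ i, 0 ≤ v i) (hAB : A ⊆ B) {i : ι}
    (hiB : i ∈ B) (hiA : i ∉ A) :
    ∑ k, v k * signVector A k + 2 * v i ≤ ∑ k, v k * signVector B k := by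
  have hmono : ∀ k, v k * signVector A k ≤ v k * signVector B k := fun k => by
    by_cases hA : k ∈ A
    · rw [signVector_of_mem hA, signVector_of_mem (hAB hA)]
    · refine mul_le_mul_of_nonneg_left ?_ (hv k)
      rw [signVector_of_notMem hA]
      by_cases hB : k ∈ B
      · rw [signVector_of_mem hB]; norm_num
      · rw [signVector_of_notMem hB]
  have hflip := Finset.single_le_sum (f := fun k => v k * signVector B k - v k * signVector A k)
    (fun k _ => sub_nonneg.2 (hmono k)) (Finset.mem_univ i)
  rw [Finset.sum_sub_distrib] at hflip
  simp only [signVector_of_mem hiB, signVector_of_notMem hiA] at hflip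
  linarith

/-- Enlarging `A` raises the sum by more than the length of `[-C, C]`, so that Sperner's theorem
applies. -/
theorem ncard_abs_add_sum_mul_signVector_le (hC : 0 ≤ C) (hv : ∀ i, C < v i) (y : ℝ) :
    {A : Finset ι | |y + ∑ i, v i * signVector A i| ≤ C}.ncard ≤
      (Fintype.card ι).choose (Fintype.card ι / 2) := by
  classical
  rw [← Finset.coe_filter_univ, Set.ncard_coe_finset]
  refine IsAntichain.sperner fun A hA B hB hAB hsub => ?_
  simp only [Finset.coe_filter, Finset.mem_univ, true_and, Set.mem_ofPred_eq] at hA hB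
  obtain ⟨i, hiB, hiA⟩ := Finset.exists_of_ssubset (hsub.ssubset_of_ne hAB)
  have hflip := sum_mul_signVector_add_le (fun k => hC.trans (hv k).le) hsub hiB hiA
  linarith [(abs_le.1 hA).1, (abs_le.1 hB).2, hv i]

variable {Ω : Type*} [MeasurableSpace Ω] {μ : Measure Ω} {Z : ι → Ω → ℝ}

theorem measure_eq_signVector (hZ : ∀ i, IsRademacher (Z i) μ) (hind : iIndepFun Z μ)
    (A : Finset ι) : μ {ω | ∀ i, Z i ω = signVector A i} = (1 / 2) ^ Fintype.card ι := by
  have hset : {ω | ∀ i, Z i ω = signVector A i} = ⋂ i ∈ Finset.univ, Z i ⁻¹' {signVector A i} := by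
    ext ω; simp
  have hsign : ∀ i ∈ Finset.univ, μ (Z i ⁻¹' {signVector A i}) = 1 / 2 := fun i _ => by
    by_cases hi : i ∈ A
    · rw [signVector_of_mem hi]; exact (hZ i).prob_one
    · rw [signVector_of_notMem hi]; exact (hZ i).prob_neg_one
  rw [hset, hind.measure_inter_preimage_eq_mul Finset.univ fun i _ => measurableSet_singleton _,
    Finset.prod_congr rfl hsign, Finset.prod_const, Finset.card_univ]

theorem measureReal_abs_add_sum_le [IsProbabilityMeasure μ] (hZ : ∀ i, IsRademacher (Z i) μ)
    (hind : iIndepFun Z μ) (hC : 0 ≤ C) (hv : ∀ i, C < v i) (y : ℝ) :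
    μ.real {ω | |y + ∑ i, v i * Z i ω| ≤ C} ≤ 1 / √(Fintype.card ι + 1) := by
  classical
  set 𝒜 := Finset.univ.filter fun A : Finset ι => |y + ∑ i, v i * signVector A i| ≤ C with h𝒜
  have hcard : 𝒜.card ≤ (Fintype.card ι).choose (Fintype.card ι / 2) := by
    rw [← Set.ncard_coe_finset, Finset.coe_filter_univ]
    exact ncard_abs_add_sum_mul_signVector_le hC hv y
  have hcover : μ {ω | |y + ∑ i, v i * Z i ω| ≤ C} ≤
      μ (⋃ A ∈ 𝒜, {ω | ∀ i, Z i ω = signVector A i}) := by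
    refine measure_mono_ae ?_
    filter_upwards [ae_exists_forall_eq_signVector hZ] with ω ⟨A, hA⟩ hω
    refine Set.mem_iUnion₂.2 ⟨A, ?_, hA⟩
    have hω' : |y + ∑ i, v i * Z i ω| ≤ C := hω
    simpa only [h𝒜, Finset.mem_filter, Finset.mem_univ, true_and, hA] using hω'
  have hunion : μ (⋃ A ∈ 𝒜, {ω | ∀ i, Z i ω = signVector A i}) ≤
      𝒜.card * (1 / 2) ^ Fintype.card ι := by
    refine (measure_biUnion_finset_le _ _).trans (le_of_eq ?_)
    simp only [measure_eq_signVector hZ hind, Finset.sum_const, nsmul_eq_mul]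
  have hreal : μ.real {ω | |y + ∑ i, v i * Z i ω| ≤ C} ≤ 𝒜.card * (1 / 2) ^ Fintype.card ι := by
    simpa [measureReal_def] using ENNReal.toReal_mono (by finiteness) (hcover.trans hunion)
  calc μ.real {ω | |y + ∑ i, v i * Z i ω| ≤ C} ≤ 𝒜.card / 2 ^ Fintype.card ι := by
        simpa [div_eq_mul_inv] using hreal
    _ ≤ (Fintype.card ι).choose (Fintype.card ι / 2) / 2 ^ Fintype.card ι := by gcongr
    _ ≤ 1 / √(Fintype.card ι + 1) := choose_half_div_two_pow_le _

end LittlewoodOfford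

/-- The steps `b k * Y k` of a walk with step sizes `b` and signs `Y`. -/
def weightedSteps {Ω : Type*} (b : ℕ → ℝ) (Y : ℕ → Ω → ℝ) (k : ℕ) (ω : Ω) : ℝ :=
  b k * Y k ω

section WeightedSteps

variable {Ω : Type*} [MeasurableSpace Ω] {μ : Measure Ω} {Y : ℕ → Ω → ℝ}

theorem measurable_weightedSteps (hY : ∀ k, IsRademacher (Y k) μ) (b : ℕ → ℝ) (k : ℕ) :
    Measurable (weightedSteps b Y k) :=
  (hY k).measurable.const_mul (b k)

theorem iIndepFun_weightedSteps (hind : iIndepFun Y μ) (b : ℕ → ℝ) :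
    iIndepFun (weightedSteps b Y) μ :=
  hind.comp (fun k x => b k * x) fun k => measurable_const_mul (b k)

variable [IsProbabilityMeasure μ]

theorem measureReal_abs_add_increment_le (hY : ∀ k, IsRademacher (Y k) μ) (hind : iIndepFun Y μ)
    {C : ℝ} (hC : 0 ≤ C) {b : ℕ → ℝ} {m n : ℕ} (hb : ∀ k, m ≤ k → k < n → C < b k) (y : ℝ) :
    μ.real {ω | |y + increment (weightedSteps b Y) m n ω| ≤ C} ≤ 1 / √((n - m : ℕ) + 1) := by
  have hsum := measureReal_abs_add_sum_le (Z := fun k : Finset.Ico m n => Y k) (fun k => hY k)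
    (hind.precomp Subtype.val_injective) hC
    (v := fun k : Finset.Ico m n => b k)
    (fun k => hb k (Finset.mem_Ico.1 k.2).1 (Finset.mem_Ico.1 k.2).2) y
  rw [Fintype.card_coe, Nat.card_Ico] at hsum
  convert hsum using 7 with ω
  exact (Finset.sum_coe_sort (Finset.Ico m n) fun k => b k * Y k ω).symm

theorem charFun_map_increment_weightedSteps (hY : ∀ k, IsRademacher (Y k) μ)
    (hind : iIndepFun Y μ) (b : ℕ → ℝ) (m n : ℕ) (t : ℝ) :
    charFun (μ.map (increment (weightedSteps b Y) m n)) t =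
      (∏ k ∈ Finset.Ico m n, Real.cos (b k * t) : ℝ) := by
  have hprod := ((iIndepFun_weightedSteps hind b).restrict (Finset.Ico m n)
    ).charFun_map_fun_finsetSum_eq_prod fun k _ => (measurable_weightedSteps hY b k).aemeasurable
  rw [Complex.ofReal_prod]
  refine (congrFun hprod t).trans ?_
  rw [Finset.prod_apply]
  exact Finset.prod_congr rfl fun k _ => (hY k).charFun_map_const_mul (b k) t

end WeightedSteps

section WalkFourier

variable {Ω : Type*} [MeasurableSpace Ω] {μ : Measure Ω} [IsProbabilityMeasure μ] {Y : ℕ → Ω → ℝ}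

theorem integral_schwartz_add_increment (hY : ∀ k, IsRademacher (Y k) μ) (hind : iIndepFun Y μ)
    (f : 𝓢(ℝ, ℂ)) (b : ℕ → ℝ) (m n : ℕ) (y : ℝ) :
    ∫ ω, f (y + increment (weightedSteps b Y) m n ω) ∂μ =
      ∫ v, 𝓕 f v * Complex.exp ((2 * Real.pi * v * y : ℝ) * Complex.I) *
        (∏ k ∈ Finset.Ico m n, Real.cos (b k * (2 * Real.pi * v)) : ℝ) := by
  have hS : Measurable (increment (weightedSteps b Y) m n) :=
    measurable_increment (measurable_weightedSteps hY b) m n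
  have := Measure.isProbabilityMeasure_map (μ := μ) hS.aemeasurable
  rw [← integral_map hS.aemeasurable (f := fun x => f (y + x))
    (f.continuous.comp (continuous_const_add y)).aestronglyMeasurable,
    integral_schwartz_add_eq_integral_fourier_mul_charFun]
  simp only [charFun_map_increment_weightedSteps hY hind]

theorem norm_integral_schwartz_add_increment_le (hY : ∀ k, IsRademacher (Y k) μ)
    (hind : iIndepFun Y μ) (f : 𝓢(ℝ, ℂ)) (b : ℕ → ℝ) (m n : ℕ) (y : ℝ) :
    ‖∫ ω, f (y + increment (weightedSteps b Y) m n ω) ∂μ‖ ≤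
      ∫ v, ‖𝓕 f v‖ * ∏ k ∈ Finset.Ico m n, |Real.cos (b k * (2 * Real.pi * v))| := by
  rw [integral_schwartz_add_increment hY hind]
  refine (norm_integral_le_integral_norm _).trans (le_of_eq ?_)
  simp only [norm_mul, Complex.norm_exp_ofReal_mul_I, mul_one, Complex.norm_real, norm_prod,
    Real.norm_eq_abs]

end WalkFourier

section UpperBound

variable {u : ℕ}

theorem integrable_norm_mul_one_add_abs (g : 𝓢(ℝ, ℂ)) :
    Integrable fun v => ‖g v‖ * (1 + 8 * Real.pi * |v|) := by
  have hmoment := (g.integrable_pow_mul volume 1).const_mul (8 * Real.pi)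
  refine (g.integrable.norm.add hmoment).congr (Eventually.of_forall fun v => ?_)
  simp only [Pi.add_apply, pow_one, Real.norm_eq_abs]
  ring

theorem integral_exp_neg_mul_two_pi_mul_sq (a : ℝ) :
    ∫ v : ℝ, Real.exp (-a * (2 * Real.pi * v) ^ 2) = √(1 / (4 * Real.pi * a)) := by
  have hgauss := integral_gaussian (4 * Real.pi ^ 2 * a)
  rw [show Real.pi / (4 * Real.pi ^ 2 * a) = 1 / (4 * Real.pi * a) by
    rw [pow_two]; field_simp] at hgauss
  rw [← hgauss]
  congr 1 with v
  ring_nf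

theorem IsLargeScale.norm_mul_prod_abs_cos_le (hu : IsLargeScale u) {n j : ℕ} (hn : u ^ 4 ≤ n)
    (hnj : n + j ≤ 4 * u ^ 4) (hj : u ^ 3 ≤ j) {z : ℂ} {B : ℝ} (hz : ‖z‖ ≤ B) (v : ℝ) :
    ‖z‖ * ∏ k ∈ Finset.Ico n (n + j), |Real.cos (logStep k * (2 * Real.pi * v))| ≤
      B * Real.exp (-(j * logScale u ^ 2 / 32) * (2 * Real.pi * v) ^ 2) +
        ‖z‖ * (1 + 8 * Real.pi * |v|) / u ^ 4 := by
  have hB : 0 ≤ B := (norm_nonneg z).trans hz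
  rcases le_total |2 * Real.pi * v| (1 / logScale u) with hnear | hfar
  · refine le_trans ?_ (le_add_of_nonneg_right (by positivity))
    gcongr
    exact hu.prod_abs_cos_le_of_near hn hnj hnear
  · refine le_trans ?_ (le_add_of_nonneg_left (by positivity))
    rw [mul_div_assoc]
    refine mul_le_mul_of_nonneg_left ?_ (norm_nonneg z)
    refine (hu.prod_abs_cos_le_of_far hn hnj hj hfar).trans (le_of_eq ?_)
    rw [abs_mul, abs_of_pos Real.two_pi_pos]
    ring

theorem sqrt_one_div_mul_sq_le {j : ℕ} (hj : 0 < j) {l : ℝ} (hl : 0 < l) :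
    √(1 / (4 * Real.pi * (j * l ^ 2 / 32))) ≤ 4 / (√(j + 1) * l) := by
  have hj' : (1 : ℝ) ≤ j := by exact_mod_cast hj
  rw [Real.sqrt_le_left (by positivity), div_pow, mul_pow, Real.sq_sqrt (by positivity),
    div_le_div_iff₀ (by positivity) (by positivity)]
  have hpi : ((j : ℝ) + 1) ≤ 2 * Real.pi * j := by nlinarith [Real.pi_gt_three]
  nlinarith [sq_nonneg l]

theorem exists_integral_norm_mul_prod_abs_cos_le (g : 𝓢(ℝ, ℂ)) :
    ∃ K, 0 ≤ K ∧ ∀ u, IsLargeScale u → ∀ n j, u ^ 4 ≤ n → n + j ≤ 4 * u ^ 4 → u ^ 3 ≤ j →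
      ∫ v, ‖g v‖ * ∏ k ∈ Finset.Ico n (n + j), |Real.cos (logStep k * (2 * Real.pi * v))| ≤
        K / (√(j + 1) * logScale u) := by
  obtain ⟨B, hB, hgB⟩ := g.decay 0 0
  simp only [pow_zero, one_mul, norm_iteratedFDeriv_zero] at hgB
  set I := ∫ v, ‖g v‖ * (1 + 8 * Real.pi * |v|)
  have : 0 ≤ I := integral_nonneg fun v => by positivity
  refine ⟨4 * B + I, by positivity, fun u hu n j hn hnj hj => ?_⟩
  have hl := hu.one_le_logScale
  have hupos := hu.pos
  have hjpos : 0 < j := (pow_pos hupos 3).trans_le hj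
  set a := (j : ℝ) * logScale u ^ 2 / 32
  have ha : 0 < a := by positivity
  have hgauss : Integrable fun v : ℝ => Real.exp (-a * (2 * Real.pi * v) ^ 2) :=
    (integrable_exp_neg_mul_sq ha).comp_mul_left' Real.two_pi_pos.ne'
  have hfar := (integrable_norm_mul_one_add_abs g).div_const ((u : ℝ) ^ 4)
  calc ∫ v, ‖g v‖ * ∏ k ∈ Finset.Ico n (n + j), |Real.cos (logStep k * (2 * Real.pi * v))|
      ≤ ∫ v, (B * Real.exp (-a * (2 * Real.pi * v) ^ 2) +
          ‖g v‖ * (1 + 8 * Real.pi * |v|) / u ^ 4) :=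
        integral_mono_of_nonneg (Eventually.of_forall fun v => by positivity)
          ((hgauss.const_mul B).add hfar)
          (Eventually.of_forall fun v => hu.norm_mul_prod_abs_cos_le hn hnj hj (hgB v) v)
    _ = B * √(1 / (4 * Real.pi * a)) + I / u ^ 4 := by
        rw [integral_add (hgauss.const_mul B) hfar, integral_const_mul, integral_div,
          integral_exp_neg_mul_two_pi_mul_sq]
    _ ≤ B * (4 / (√(j + 1) * logScale u)) + I / (√(j + 1) * logScale u) := by
        gcongr
        · exact sqrt_one_div_mul_sq_le hjpos (by positivity)
        · have := pow_pos hupos 4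
          exact hu.sqrt_mul_logScale_le (by omega)
    _ = (4 * B + I) / (√(j + 1) * logScale u) := by ring

end UpperBound

section LowerBound

variable {u : ℕ}

theorem tendsto_logScale_atTop : Tendsto logScale atTop atTop := by
  have hpow : Tendsto (fun u : ℕ => (4 : ℝ) * u ^ 4) atTop atTop :=
    ((tendsto_pow_atTop (by norm_num)).comp tendsto_natCast_atTop_atTop).const_mul_atTop four_pos
  exact Real.tendsto_log_atTop.comp hpow

theorem eventually_half_re_le_re_mul_exp {g : ℝ → ℂ} (hg : Continuous g) (h0 : 0 < (g 0).re)
    (L : ℝ) : ∀ᶠ v in 𝓝 (0 : ℝ), ∀ x, |x| ≤ L →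
      (g 0).re / 2 ≤ (g v * Complex.exp ((2 * Real.pi * v * x : ℝ) * Complex.I)).re := by
  have hcompact : IsCompact (Set.Icc (-L) L) := isCompact_Icc
  have hnear := hcompact.eventually_forall_of_forall_eventually (x₀ := (0 : ℝ))
    (P := fun v x => (g 0).re / 2 ≤
      (g v * Complex.exp ((2 * Real.pi * v * x : ℝ) * Complex.I)).re) fun x _ => by
    have hcont : Continuous fun z : ℝ × ℝ =>
        (g z.1 * Complex.exp ((2 * Real.pi * z.1 * z.2 : ℝ) * Complex.I)).re := by fun_prop
    refine (hcont.tendsto (0, x)).eventually (eventually_ge_nhds ?_)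
    simpa using h0
  filter_upwards [hnear] with v hv x hx using hv x (abs_le.1 hx)

theorem abs_logStep_mul_le {k : ℕ} (hk : k + 1 ≤ 4 * u ^ 4) (t : ℝ) :
    |logStep k * t| ≤ logScale u * |t| := by
  have hstep : 0 ≤ logStep k := Real.log_nonneg (le_add_of_nonneg_left k.cast_nonneg)
  rw [abs_mul, abs_of_nonneg hstep]
  gcongr
  exact logStep_le_logScale hk

namespace IsLargeScale

theorem abs_logStep_mul_le_one (hu : IsLargeScale u) {k : ℕ} (hk : k + 1 ≤ 4 * u ^ 4) {t : ℝ}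
    (ht : |t| ≤ 1 / logScale u) : |logStep k * t| ≤ 1 := by
  have hl := hu.one_le_logScale
  calc |logStep k * t| ≤ logScale u * |t| := abs_logStep_mul_le hk t
    _ ≤ logScale u * (1 / logScale u) := by gcongr
    _ = 1 := mul_one_div_cancel (by positivity)

theorem prod_cos_nonneg (hu : IsLargeScale u) {m n : ℕ} (hn : n ≤ 4 * u ^ 4) {t : ℝ}
    (ht : |t| ≤ 1 / logScale u) : 0 ≤ ∏ k ∈ Finset.Ico m n, Real.cos (logStep k * t) := by
  refine Finset.prod_nonneg fun k hk => ?_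
  rw [Finset.mem_Ico] at hk
  exact (Real.cos_pos_of_le_one (hu.abs_logStep_mul_le_one (by omega) ht)).le

theorem half_le_prod_cos (hu : IsLargeScale u) {m n : ℕ} (hn : n ≤ 4 * u ^ 4) {t : ℝ}
    (ht : |t| ≤ 1 / (2 * u ^ 2 * logScale u)) :
    1 / 2 ≤ ∏ k ∈ Finset.Ico m n, Real.cos (logStep k * t) := by
  have hl := hu.one_le_logScale
  have hu0 := hu.le_cast
  have ht' : |t| ≤ 1 / logScale u :=
    ht.trans (one_div_le_one_div_of_le (by positivity) (le_mul_of_one_le_left (by positivity)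
      (by nlinarith)))
  have hterm : ∀ k ∈ Finset.Ico m n, (logStep k * t) ^ 2 ≤ 1 / (4 * u ^ 4) := by
    intro k hk
    rw [Finset.mem_Ico] at hk
    calc (logStep k * t) ^ 2 = |logStep k * t| ^ 2 := (sq_abs _).symm
      _ ≤ (logScale u * (1 / (2 * u ^ 2 * logScale u))) ^ 2 := by
          gcongr
          exact (abs_logStep_mul_le (hk.2.trans_le hn) t).trans (by gcongr)
      _ = 1 / (4 * u ^ 4) := by field_simp; norm_num
  have hsum : ∑ k ∈ Finset.Ico m n, (logStep k * t) ^ 2 ≤ 1 := by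
    have hcard : (((Finset.Ico m n).card : ℕ) : ℝ) ≤ 4 * u ^ 4 := by
      rw [Nat.card_Ico]
      exact_mod_cast (Nat.sub_le n m).trans hn
    calc ∑ k ∈ Finset.Ico m n, (logStep k * t) ^ 2
        ≤ (Finset.Ico m n).card * (1 / (4 * (u : ℝ) ^ 4)) := by
          rw [← nsmul_eq_mul]
          exact Finset.sum_le_card_nsmul _ _ _ hterm
      _ ≤ 4 * u ^ 4 * (1 / (4 * (u : ℝ) ^ 4)) := by gcongr
      _ = 1 := mul_one_div_cancel (by positivity)
  have hcos := one_sub_sum_sq_div_two_le_prod_cos (Finset.Ico m n) fun k hk =>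
    hu.abs_logStep_mul_le_one ((Finset.mem_Ico.1 hk).2.trans_le hn) ht'
  linarith

theorem prod_abs_cos_le_of_far_of_le (hu : IsLargeScale u) {m n : ℕ} (hm : m ≤ u ^ 4)
    (hn : 2 * u ^ 4 ≤ n) {t : ℝ} (ht : 1 / logScale u ≤ |t|) :
    ∏ k ∈ Finset.Ico m n, |Real.cos (logStep k * t)| ≤ (1 + 4 * |t|) / u ^ 4 :=
  calc ∏ k ∈ Finset.Ico m n, |Real.cos (logStep k * t)|
      ≤ ∏ k ∈ Finset.Ico (u ^ 4) (u ^ 4 + u ^ 4), |Real.cos (logStep k * t)| :=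
        Finset.prod_le_prod_of_subset_of_le_one (Finset.Ico_subset_Ico hm (by omega))
          (fun _ _ => abs_nonneg _) fun _ _ _ => Real.abs_cos_le_one _
    _ ≤ (1 + 4 * |t|) / u ^ 4 :=
        hu.prod_abs_cos_le_of_far le_rfl (by omega) (Nat.pow_le_pow_right hu.pos (by norm_num)) ht

theorem indicator_sub_le_re_mul_prod_cos (hu : IsLargeScale u) {m n : ℕ} (hm : m ≤ u ^ 4)
    (hn : 2 * u ^ 4 ≤ n) (hn' : n ≤ 4 * u ^ 4) {z : ℂ} {η t : ℝ} (hη : 0 ≤ η)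
    (hz : |t| ≤ 1 / logScale u → η ≤ z.re) :
    {s : ℝ | |s| ≤ 1 / (2 * u ^ 2 * logScale u)}.indicator (fun _ => η / 2) t -
        ‖z‖ * ((1 + 4 * |t|) / u ^ 4) ≤
      (z * (∏ k ∈ Finset.Ico m n, Real.cos (logStep k * t) : ℝ)).re := by
  have hl := hu.one_le_logScale
  have hu0 := hu.le_cast
  have hradius : 1 / (2 * u ^ 2 * logScale u) ≤ 1 / logScale u :=
    one_div_le_one_div_of_le (by positivity) (le_mul_of_one_le_left (by positivity) (by nlinarith))
  rw [Complex.re_mul_ofReal]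
  rcases le_or_gt |t| (1 / logScale u) with hnear | hfar
  · have herr : 0 ≤ ‖z‖ * ((1 + 4 * |t|) / u ^ 4) := by positivity
    have hprod := hu.prod_cos_nonneg (m := m) hn' hnear
    by_cases ht : |t| ≤ 1 / (2 * u ^ 2 * logScale u)
    · rw [Set.indicator_of_mem (by exact ht)]
      nlinarith [hu.half_le_prod_cos (m := m) hn' ht, hz hnear]
    · rw [Set.indicator_of_notMem (by exact ht)]
      linarith [mul_nonneg (hη.trans (hz hnear)) hprod]
  · rw [Set.indicator_of_notMem (by simpa using hradius.trans_lt hfar)]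
    have habs : |z.re * ∏ k ∈ Finset.Ico m n, Real.cos (logStep k * t)| ≤
        ‖z‖ * ((1 + 4 * |t|) / u ^ 4) := by
      rw [abs_mul, Finset.abs_prod]
      gcongr
      · exact Complex.abs_re_le_norm z
      · exact hu.prod_abs_cos_le_of_far_of_le hm hn hfar.le
    linarith [neg_abs_le (z.re * ∏ k ∈ Finset.Ico m n, Real.cos (logStep k * t))]

end IsLargeScale

end LowerBound

section LowerBoundIntegral

variable {u : ℕ}

theorem setOf_abs_two_pi_mul_le_eq_Icc (ρ : ℝ) :
    {v : ℝ | |2 * Real.pi * v| ≤ ρ} = Set.Icc (-(ρ / (2 * Real.pi))) (ρ / (2 * Real.pi)) := by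
  ext v
  rw [Set.mem_ofPred_eq, abs_mul, abs_of_pos Real.two_pi_pos, ← le_div_iff₀' Real.two_pi_pos,
    abs_le, Set.mem_Icc]

theorem volume_real_setOf_abs_two_pi_mul_le {ρ : ℝ} (hρ : 0 ≤ ρ) :
    volume.real {v : ℝ | |2 * Real.pi * v| ≤ ρ} = ρ / Real.pi := by
  rw [setOf_abs_two_pi_mul_le_eq_Icc,
    Real.volume_real_Icc_of_le (neg_le_self (by positivity))]
  field_simp
  ring

theorem integrable_mul_exp_mul_prod_cos (g : 𝓢(ℝ, ℂ)) (b : ℕ → ℝ) (m n : ℕ) (x : ℝ) :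
    Integrable fun v => g v * Complex.exp ((2 * Real.pi * v * x : ℝ) * Complex.I) *
      (∏ k ∈ Finset.Ico m n, Real.cos (b k * (2 * Real.pi * v)) : ℝ) := by
  refine Integrable.mul_bdd (c := 1)
    (g.integrable.mul_bdd (c := 1) (by fun_prop) ?_) (by fun_prop) ?_
  · exact Eventually.of_forall fun v => (Complex.norm_exp_ofReal_mul_I _).le
  · refine Eventually.of_forall fun v => ?_
    rw [Complex.norm_real, norm_prod]
    exact Finset.prod_le_one (fun _ _ => norm_nonneg _) fun _ _ => Real.abs_cos_le_one _

theorem IsLargeScale.sub_le_re_integral_mul_prod_cos (hu : IsLargeScale u) (g : 𝓢(ℝ, ℂ)) {m n : ℕ}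
    (hm : m ≤ u ^ 4) (hn : 2 * u ^ 4 ≤ n) (hn' : n ≤ 4 * u ^ 4) {x η : ℝ} (hη : 0 ≤ η)
    (hg : ∀ v, |2 * Real.pi * v| ≤ 1 / logScale u →
      η ≤ (g v * Complex.exp ((2 * Real.pi * v * x : ℝ) * Complex.I)).re) :
    η / (4 * Real.pi * (u ^ 2 * logScale u)) - (∫ v, ‖g v‖ * (1 + 8 * Real.pi * |v|)) / u ^ 4 ≤
      (∫ v, g v * Complex.exp ((2 * Real.pi * v * x : ℝ) * Complex.I) *
        (∏ k ∈ Finset.Ico m n, Real.cos (logStep k * (2 * Real.pi * v)) : ℝ)).re := by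
  have hl := hu.one_le_logScale
  set ρ := 1 / (2 * u ^ 2 * logScale u) with hρ
  set E := {v : ℝ | |2 * Real.pi * v| ≤ ρ} with hE
  have hρ0 : 0 ≤ ρ := by positivity
  have hEmeas : MeasurableSet E := measurableSet_le (by fun_prop) measurable_const
  have hvol : volume.real E = ρ / Real.pi := volume_real_setOf_abs_two_pi_mul_le hρ0
  have hEfin : volume E ≠ ∞ := by
    rw [hE, setOf_abs_two_pi_mul_le_eq_Icc]
    exact measure_Icc_lt_top.ne
  have hmain : Integrable (E.indicator fun _ => η / 2) :=
    (integrable_indicator_iff hEmeas).2 (integrableOn_const hEfin)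
  have herr := (integrable_norm_mul_one_add_abs g).div_const ((u : ℝ) ^ 4)
  have hint := integrable_mul_exp_mul_prod_cos g logStep m n x
  calc η / (4 * Real.pi * (u ^ 2 * logScale u)) - (∫ v, ‖g v‖ * (1 + 8 * Real.pi * |v|)) / u ^ 4
      = ∫ v, (E.indicator (fun _ => η / 2) v - ‖g v‖ * (1 + 8 * Real.pi * |v|) / u ^ 4) := by
        rw [integral_sub hmain herr, integral_indicator_const _ hEmeas, integral_div, hvol, hρ,
          smul_eq_mul]
        congr 1
        field_simp
        norm_num
    _ ≤ ∫ v, (g v * Complex.exp ((2 * Real.pi * v * x : ℝ) * Complex.I) *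
          (∏ k ∈ Finset.Ico m n, Real.cos (logStep k * (2 * Real.pi * v)) : ℝ)).re := by
        refine integral_mono (hmain.sub herr) hint.re fun v => ?_
        have hpoint := hu.indicator_sub_le_re_mul_prod_cos hm hn hn' hη (hg v)
        rw [norm_mul, Complex.norm_exp_ofReal_mul_I, mul_one, abs_mul, abs_of_pos Real.two_pi_pos]
          at hpoint
        have hind : E.indicator (fun _ => η / 2) v =
            {s | |s| ≤ ρ}.indicator (fun _ => η / 2) (2 * Real.pi * v) := rfl
        rw [hind, mul_div_assoc, show 8 * Real.pi * |v| = 4 * (2 * Real.pi * |v|) by ring]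
        exact hpoint
    _ = _ := Complex.reCLM.integral_comp_comm hint

theorem exists_le_re_integral_mul_prod_cos (g : 𝓢(ℝ, ℂ)) (h0 : 0 < (g 0).re) :
    ∃ κ, 0 < κ ∧ ∀ (L : ℝ) (m : ℕ), ∀ᶠ u in atTop, ∀ n, 2 * u ^ 4 ≤ n → n ≤ 4 * u ^ 4 →
      ∀ x, |x| ≤ L → κ / (u ^ 2 * logScale u) ≤
        (∫ v, g v * Complex.exp ((2 * Real.pi * v * x : ℝ) * Complex.I) *
          (∏ k ∈ Finset.Ico m n, Real.cos (logStep k * (2 * Real.pi * v)) : ℝ)).re := by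
  set η := (g 0).re / 2
  have hη : 0 < η := half_pos h0
  set I := ∫ v, ‖g v‖ * (1 + 8 * Real.pi * |v|)
  have hpi := Real.pi_pos
  refine ⟨η / (8 * Real.pi), by positivity, fun L m => ?_⟩
  obtain ⟨ε, hε, hnear⟩ :=
    Metric.eventually_nhds_iff.1 (eventually_half_re_le_re_mul_exp g.continuous h0 L)
  filter_upwards [eventually_isLargeScale, eventually_ge_atTop m,
    tendsto_logScale_atTop.eventually_gt_atTop (1 / ε),
    tendsto_natCast_atTop_atTop.eventually_ge_atTop (8 * Real.pi * I / η)] with u hu hmu hlε hIu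
    n hn hn' x hx
  have hl := hu.one_le_logScale
  have hu0 := hu.le_cast
  have hm : m ≤ u ^ 4 := hmu.trans (Nat.le_self_pow (by norm_num) u)
  have hg : ∀ v, |2 * Real.pi * v| ≤ 1 / logScale u →
      η ≤ (g v * Complex.exp ((2 * Real.pi * v * x : ℝ) * Complex.I)).re := fun v hv => by
    refine hnear ?_ x hx
    rw [Real.dist_eq, sub_zero]
    calc |v| ≤ 2 * Real.pi * |v| :=
          le_mul_of_one_le_left (abs_nonneg v) (by linarith [Real.pi_gt_three])
      _ = |2 * Real.pi * v| := by rw [abs_mul, abs_of_pos Real.two_pi_pos]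
      _ ≤ 1 / logScale u := hv
      _ < ε := (one_div_lt hε (by positivity)).1 hlε
  have herr : I / u ^ 4 ≤ η / (8 * Real.pi) / (u ^ 2 * logScale u) := by
    have hlu : logScale u ≤ u := by
      linarith [hu.pow_logScale_le_cast (i := 1) (by norm_num), pow_one (logScale u)]
    rw [div_le_iff₀ hη] at hIu
    rw [div_div, div_le_div_iff₀ (by positivity) (by positivity)]
    calc I * (8 * Real.pi * (u ^ 2 * logScale u))
        = 8 * Real.pi * I * (u ^ 2 * logScale u) := by ring
      _ ≤ u * η * (u ^ 2 * u) := by gcongr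
      _ = η * u ^ 4 := by ring
  have hmain : η / (4 * Real.pi * (u ^ 2 * logScale u)) =
      2 * (η / (8 * Real.pi) / (u ^ 2 * logScale u)) := by
    field_simp
    norm_num
  linarith [hu.sub_le_re_integral_mul_prod_cos g hm hn hn' hη.le hg]

end LowerBoundIntegral

/-- `φ` is a bump function that is supported in `[-C, C]`, `f` is `φ` as a complex-valued Schwartz
function, and the Fourier transform of `f` is positive at `0`. -/
structure IsFourierBump (C : ℝ) (φ : ℝ → ℝ) (f : 𝓢(ℝ, ℂ)) : Prop where
  coe_eq : ∀ x, f x = φ x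
  nonneg : ∀ x, 0 ≤ φ x
  le_one : ∀ x, φ x ≤ 1
  eq_zero : ∀ x, C < |x| → φ x = 0
  re_fourier_zero_pos : 0 < (𝓕 f 0).re

theorem exists_isFourierBump {C : ℝ} (hC : 0 < C) : ∃ φ f, IsFourierBump C φ f := by
  let β : ContDiffBump (0 : ℝ) := ⟨C / 2, C, half_pos hC, half_lt_self hC⟩
  have hsupp : HasCompactSupport fun x => (β x : ℂ) :=
    β.hasCompactSupport.comp_left (g := fun x : ℝ => (x : ℂ)) Complex.ofReal_zero
  have hsmooth : ContDiff ℝ (⊤ : ℕ∞) fun x => (β x : ℂ) :=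
    Complex.ofRealCLM.contDiff.comp β.contDiff
  refine ⟨β, hsupp.toSchwartzMap hsmooth, fun x => rfl, fun x => β.nonneg, fun x => β.le_one,
    fun x hx => β.zero_of_le_dist ?_, ?_⟩
  · simpa using hx.le
  · have hzero : 𝓕 (hsupp.toSchwartzMap hsmooth) 0 = ((∫ x, β x : ℝ) : ℂ) := by
      rw [SchwartzMap.fourier_coe, Real.fourier_eq', ← integral_complex_ofReal]
      simp
    rw [hzero, Complex.ofReal_re]
    exact β.integral_pos

namespace IsFourierBump

variable {C : ℝ} {φ : ℝ → ℝ} {f : 𝓢(ℝ, ℂ)}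

theorem continuous (h : IsFourierBump C φ f) : Continuous φ := by
  have hre : φ = fun x => (f x).re := funext fun x => by rw [h.coe_eq, Complex.ofReal_re]
  rw [hre]
  exact Complex.continuous_re.comp f.continuous

variable {Ω : Type*} [MeasurableSpace Ω] {μ : Measure Ω} {S : Ω → ℝ}

theorem integral_coe_comp (h : IsFourierBump C φ f) : ∫ ω, f (S ω) ∂μ = (∫ ω, φ (S ω) ∂μ : ℝ) := by
  simp only [h.coe_eq, integral_complex_ofReal]

variable [IsFiniteMeasure μ]

theorem integrable_comp (h : IsFourierBump C φ f) (hS : Measurable S) :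
    Integrable (fun ω => φ (S ω)) μ := by
  refine .of_bound (h.continuous.measurable.comp hS).aestronglyMeasurable 1
    (Eventually.of_forall fun ω => ?_)
  rw [Real.norm_of_nonneg (h.nonneg _)]
  exact h.le_one _

theorem integral_comp_le_measureReal (h : IsFourierBump C φ f) (hS : Measurable S) :
    ∫ ω, φ (S ω) ∂μ ≤ μ.real {ω | |S ω| ≤ C} := by
  have hmeas : MeasurableSet {ω | |S ω| ≤ C} := measurableSet_le hS.abs measurable_const
  rw [← integral_indicator_one hmeas]
  refine integral_mono (h.integrable_comp hS) ((integrable_const 1).indicator hmeas) fun ω => ?_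
  by_cases hω : |S ω| ≤ C
  · rw [Set.indicator_of_mem (by exact hω)]
    exact h.le_one _
  · rw [Set.indicator_of_notMem (by exact hω)]
    exact (h.eq_zero _ (not_le.1 hω)).le

theorem lintegral_ofReal_comp (h : IsFourierBump C φ f) (hS : Measurable S) :
    ∫⁻ ω, ENNReal.ofReal (φ (S ω)) ∂μ = ENNReal.ofReal (∫ ω, φ (S ω) ∂μ) :=
  (ofReal_integral_eq_lintegral_ofReal (h.integrable_comp hS)
    (Eventually.of_forall fun _ => h.nonneg _)).symm

end IsFourierBump

section Windows

variable {Ω : Type*} [MeasurableSpace Ω] {μ : Measure Ω} [IsProbabilityMeasure μ] {Y : ℕ → Ω → ℝ}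
  {C : ℝ} {φ : ℝ → ℝ} {f : 𝓢(ℝ, ℂ)}

theorem exists_sum_lintegral_bump_le (hY : ∀ k, IsRademacher (Y k) μ) (hind : iIndepFun Y μ)
    (hC : 0 ≤ C) (hφ : IsFourierBump C φ f) :
    ∃ A, 0 < A ∧ ∀ᶠ u in atTop, ∀ m, u ^ 4 ≤ m → m ≤ 4 * u ^ 4 → ∀ y,
      ∑ n ∈ Finset.Ico m (4 * u ^ 4),
          ∫⁻ ω, ENNReal.ofReal (φ (y + increment (weightedSteps logStep Y) m n ω)) ∂μ ≤
        ENNReal.ofReal (A * (u ^ 2 / logScale u)) := by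
  obtain ⟨K, hK, hlong⟩ := exists_integral_norm_mul_prod_abs_cos_le (𝓕 f)
  refine ⟨2 + 4 * K, by positivity, ?_⟩
  filter_upwards [eventually_isLargeScale, tendsto_logScale_atTop.eventually_gt_atTop (2 * C)]
    with u hu hCu m hm hm' y
  set S := increment (weightedSteps logStep Y)
  have hS : ∀ n, Measurable fun ω => y + S m n ω := fun n =>
    (measurable_increment (measurable_weightedSteps hY logStep) m n).const_add y
  have hshort : ∀ j < u ^ 3, ∫ ω, φ (y + S m (m + j) ω) ∂μ ≤ 1 / √(j + 1) := fun j _ => by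
    have hstep : ∀ k, m ≤ k → k < m + j → C < logStep k := fun k hk _ => by
      linarith [hu.half_logScale_le_logStep (k := k) (by omega)]
    have hLO := measureReal_abs_add_increment_le hY hind hC hstep y
    rw [Nat.add_sub_cancel_left] at hLO
    exact (hφ.integral_comp_le_measureReal (hS _)).trans hLO
  have hfar : ∀ j, u ^ 3 ≤ j → j < 4 * u ^ 4 - m →
      ∫ ω, φ (y + S m (m + j) ω) ∂μ ≤ K / (√(j + 1) * logScale u) := fun j hj hjm =>
    calc ∫ ω, φ (y + S m (m + j) ω) ∂μ ≤ ‖∫ ω, f (y + S m (m + j) ω) ∂μ‖ := by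
          rw [hφ.integral_coe_comp, Complex.norm_real]
          exact le_abs_self _
      _ ≤ _ := norm_integral_schwartz_add_increment_le hY hind f logStep m (m + j) y
      _ ≤ _ := hlong u hu m j hm (by omega) hj
  have hsum := hu.sum_range_le (Nat.sub_le (4 * u ^ 4) m) hK hshort hfar
  rw [Finset.sum_Ico_eq_sum_range]
  simp only [hφ.lintegral_ofReal_comp (hS _)]
  rw [← ENNReal.ofReal_sum_of_nonneg fun j _ => integral_nonneg fun ω => hφ.nonneg _]
  exact ENNReal.ofReal_le_ofReal hsum

theorem exists_le_sum_lintegral_bump (hY : ∀ k, IsRademacher (Y k) μ) (hind : iIndepFun Y μ)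
    (hφ : IsFourierBump C φ f) :
    ∃ κ, 0 < κ ∧ ∀ (L : ℝ) (m : ℕ), ∀ᶠ u in atTop, ∀ x, |x| ≤ L →
      ENNReal.ofReal (κ * (u ^ 2 / logScale u)) ≤
        ∑ n ∈ Finset.Ico (2 * u ^ 4) (4 * u ^ 4),
          ∫⁻ ω, ENNReal.ofReal (φ (x + increment (weightedSteps logStep Y) m n ω)) ∂μ := by
  obtain ⟨κ, hκ, hlow⟩ := exists_le_re_integral_mul_prod_cos (𝓕 f) hφ.re_fourier_zero_pos
  refine ⟨2 * κ, by positivity, fun L m => ?_⟩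
  filter_upwards [hlow L m, eventually_isLargeScale] with u hu hscale x hx
  have hl := hscale.one_le_logScale
  have hpos : (0 : ℝ) < u := by exact_mod_cast hscale.pos
  set S := increment (weightedSteps logStep Y)
  have hS : ∀ n, Measurable fun ω => x + S m n ω := fun n =>
    (measurable_increment (measurable_weightedSteps hY logStep) m n).const_add x
  have hterm : ∀ n ∈ Finset.Ico (2 * u ^ 4) (4 * u ^ 4),
      κ / (u ^ 2 * logScale u) ≤ ∫ ω, φ (x + S m n ω) ∂μ := fun n hn => by
    rw [Finset.mem_Ico] at hn
    have hre := hu n hn.1 hn.2.le x hx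
    rwa [← integral_schwartz_add_increment hY hind, hφ.integral_coe_comp, Complex.ofReal_re] at hre
  have hsum := Finset.card_nsmul_le_sum _ _ _ hterm
  simp only [hφ.lintegral_ofReal_comp (hS _)]
  rw [← ENNReal.ofReal_sum_of_nonneg fun n _ => integral_nonneg fun ω => hφ.nonneg _]
  refine ENNReal.ofReal_le_ofReal (le_trans (le_of_eq ?_) hsum)
  rw [Nat.card_Ico, show 4 * u ^ 4 - 2 * u ^ 4 = 2 * u ^ 4 by omega, nsmul_eq_mul]
  push_cast
  field_simp

theorem ae_frequently_abs_increment_logStep_le (hY : ∀ k, IsRademacher (Y k) μ)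
    (hind : iIndepFun Y μ) (hC : 0 < C) :
    ∀ᵐ ω ∂μ, ∃ᶠ n in atTop, |increment (weightedSteps logStep Y) 0 n ω| ≤ C := by
  obtain ⟨φ, f, hφ⟩ := exists_isFourierBump hC
  obtain ⟨A, hA, hup⟩ := exists_sum_lintegral_bump_le hY hind hC.le hφ
  obtain ⟨κ, hκ, hlow⟩ := exists_le_sum_lintegral_bump hY hind hφ
  have hδ : ENNReal.ofReal (κ / A) ≠ 0 := by simpa using div_pos hκ hA
  refine ae_frequently_abs_increment_le_of_windows (measurable_weightedSteps hY logStep)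
    (iIndepFun_weightedSteps hind logStep)
    (ENNReal.measurable_ofReal.comp hφ.continuous.measurable)
    (fun x hx => by simp [hφ.eq_zero x hx]) hδ fun L M => ?_
  obtain ⟨u, hu, hscale, hupu, hlowu⟩ := ((eventually_ge_atTop M).and
    (eventually_isLargeScale.and (hup.and (hlow L M)))).exists
  have hl := hscale.one_le_logScale
  have hpos : (0 : ℝ) < u := by exact_mod_cast hscale.pos
  have hM : M ≤ u ^ 4 := hu.trans (Nat.le_self_pow (by norm_num) u)
  refine ⟨2 * u ^ 4, 4 * u ^ 4, ENNReal.ofReal (A * (u ^ 2 / logScale u)), by omega, by omega,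
    ?_, ENNReal.ofReal_ne_top, fun m hm y => hupu m (by have := hm.1; omega) hm.2.le y,
    fun x hx => ?_⟩
  · have : 0 < A * ((u : ℝ) ^ 2 / logScale u) := by positivity
    simpa using this
  · refine le_trans (le_of_eq ?_) (hlowu x hx)
    rw [← ENNReal.ofReal_mul (by positivity), ← mul_assoc, div_mul_cancel₀ κ hA.ne']

end Windows

theorem walk_mul_log_eq_mul_increment {Ω : Type*} (c : ℝ) (X : ℕ → Ω → ℝ) (n : ℕ) (ω : Ω) :
    walk (fun k : ℕ => c * Real.log k) X n ω =
      c * increment (weightedSteps logStep fun k => X (k + 1)) 0 n ω := by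
  rw [walk, increment, Finset.mul_sum, ← Finset.Ico_succ_right_eq_Icc, Finset.sum_Ico_eq_sum_range,
    Finset.range_eq_Ico]
  refine Finset.sum_congr rfl fun k _ => ?_
  simp only [weightedSteps, logStep, add_comm 1 k, Nat.cast_add, Nat.cast_one]
  ring

end AWalk

theorem mainTheorem7 {Ω : Type*} [MeasurableSpace Ω] (μ : Measure Ω) [IsProbabilityMeasure μ]
    (X : ℕ → Ω → ℝ) (hX : AWalk.IsRademacherSequence X μ) (c : ℝ) (hc : 0 < c) :
    ∀ᵐ ω ∂μ, ∀ C : ℝ, 0 < C →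
      AWalk.IsCRecurrent C (fun n => AWalk.walk (fun k : ℕ => c * Real.log k) X n ω) := by
  have hreturn : ∀ᵐ ω ∂μ, ∀ i : ℕ, ∃ᶠ n in atTop,
      |AWalk.increment (AWalk.weightedSteps AWalk.logStep fun k => X (k + 1)) 0 n ω| ≤
        1 / ((i : ℝ) + 1) :=
    ae_all_iff.2 fun i => AWalk.ae_frequently_abs_increment_logStep_le
      (fun k => hX.rademacher (k + 1) k.succ_pos) hX.indep Nat.one_div_pos_of_nat
  filter_upwards [hreturn] with ω hω C hC
  obtain ⟨i, hi⟩ := exists_nat_one_div_lt (div_pos hC hc)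
  refine Nat.frequently_atTop_iff_infinite.1 ((hω i).mono fun n hn => ?_)
  change |AWalk.walk (fun k : ℕ => c * Real.log k) X n ω| ≤ C
  rw [AWalk.walk_mul_log_eq_mul_increment, abs_mul, abs_of_pos hc, ← le_div_iff₀' hc]
  exact hn.trans hi.le
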